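/- **Setting.** There are $N$ transmitter-receiver pairs; pair $q$ has $n_{T_q}$ transmit and $n_{R_q}$ receive antennas, channels $\mathbf H_{qr}\in\mathbb C^{n_{R_q}\times n_{T_r}}$ with $\mathbf H_{qq}\neq 0$ of rank $r_q$, noise covariance $\mathbf R_{n_q}\succ 0$, maximum power $P_q>0$ and circuitry power $\Psi_q>0$. Player $q$ chooses $\mathbf Q_q$ in $\mathcal Q_q=\{\mathbf Q_q\succeq 0,\ \mathrm{Tr}\,\mathbf Q_q\le P_q\}$ to maximize its energy efficiency $$\mathrm{EE}_q(\mathbf Q)=\frac{\log\det(\mathbf I+\mathbf H_{qq}^H\mathbf R_q^{-1}\mathbf H_{qq}\mathbf Q_q)}{\Psi_q+\mathrm{Tr}\,\mathbf Q_q},\qquad \mathbf R_q=\mathbf R_{n_q}+\sum_{r\ne q}\mathbf H_{qr}\mathbf Q_r\mathbf H_{qr}^H .$$ Let $\mathcal G_E$ be this game. **Reduced game.** Take compact singular value decompositions $\mathbf H_{qq}=\mathbf U_{q,1}\boldsymbol\Sigma_{qq}\mathbf V_{q,1}^H$ and put $\overline{\mathbf H}_{qr}=\mathbf H_{qr}\mathbf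 V_{r,1}$. Bars denote the same quantities with $\mathbf H_{qr}$ replaced by $\overline{\mathbf H}_{qr}$ and $\mathbf Q_q$ replaced by matrices $\overline{\mathbf Q}_q\in\mathbb C^{r_q\times r_q}$. Let $\overline{\mathcal Q}=\prod_q\{\overline{\mathbf Q}_q\succeq0,\ \mathrm{Tr}\,\overline{\mathbf Q}_q\le P_q\}$ and $\partial\overline{\mathcal Q}=\prod_q\{\overline{\mathbf Q}_q\succeq0,\ \mathrm{Tr}\,\overline{\mathbf Q}_q=P_q\}$. The power mapping is $\hat{\mathbf p}=(\hat P_q)_q$ with $$\hat P_q(\overline{\mathbf Q})=\min\Big(P_q,\ \mathrm{Tr}\,\arg\max_{\mathbf X\succeq0}\overline{\mathrm{EE}}_q(\mathbf X,\overline{\mathbf Q}_{-q})\Big).$$ For a set $D$ of reduced profiles, the interference matrix $\mathbf S$ has zero diagonal and, for $r\neq q$, entries $$[\mathbf S]_{qr}=\max_{\boldsymbol\Delta\in D}\sigma_{\max}^2\Big(\big(\overline{\mathbf H}_{qq}^H\overline{\mathbf R}_q^{-1}(\boldsymbol\Delta)\overline{\mathbf H}_{qq}\big)^{-1}\overline{\mathbf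 H}_{qq}^H\overline{\mathbf R}_q^{-1}(\boldsymbol\Delta)\overline{\mathbf H}_{qr}\Big).$$ Here $D=\partial\overline{\mathcal Q}$ is allowed if, for all $q\ne s$, $r_s=1$ implies $r_q=1$ or $r_q=n_{R_q}$; and $D=\overline{\mathcal Q}$ is always allowed. **Contraction condition.** Let $\mathbf w>0$ (componentwise) be a right Perron eigenvector of $\mathbf S$, i.e. $\mathbf S\mathbf w=\rho(\mathbf S)\mathbf w$ with $\rho$ the spectral radius, and let $\|\mathbf A\|_F^{\mathbf w}=\max_q\|\mathbf A_q\|_F/w_q$ and $\|\mathbf u\|_\infty^{\mathbf w}=\max_q|u_q|/w_q$. Suppose that for all $\overline{\mathbf Q}\ne\overline{\mathbf Q}'$ in $\overline{\mathcal Q}$ $$\|\hat{\mathbf p}(\overline{\mathbf Q})-\hat{\mathbf p}(\overline{\mathbf Q}')\|_\infty^{\mathbf w}<(1-\rho(\mathbf S))\,\|\overline{\mathbf Q}-\overline{\mathbf Q}'\|_F^{\mathbf w}.$$ **Algorithm.** In the totally asynchronous energy-efficient iterative waterfilling algorithm, $\mathbf Q^{(0)}\in\prod_q\mathcal Q_q$.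 At every time $t\in\mathcal T_q$, $\mathbf Q_q^{(t+1)}$ is a best response of player $q$ in $\mathcal G_E$ to the strategies $\mathbf Q_r^{(\tau^q_r(t))}$, $r\ne q$, where $0\le\tau^q_r(t)\le t$; at every other time $\mathbf Q_q^{(t+1)}=\mathbf Q_q^{(t)}$. Total asynchronism means that each $\mathcal T_q$ is infinite and that $\tau^q_r(t)\to\infty$ as $t\to\infty$ in $\mathcal T_q$, for $r\neq q$. **Conclusion.** $\mathcal G_E$ has exactly one Nash equilibrium $\mathbf Q^{*}$. Every run under every totally asynchronous schedule converges to $\mathbf Q^{*}$, and it does so linearly in the following sense: there are $C\ge0$ and $\beta\in[0,1)$ that depend neither on the schedule nor on the run such that 1. if $0=e_0,e_1,e_2,\dots$ are times such that for every $k$ there is $a\ge e_k$ such that all updates at times $t\ge a$ use only measurements with $\tau^q_r(t)\ge e_k$ ($r\neq q$) and every player updates at least once in $[a,e_{k+1})$, then $\|\mathbf Q^{(t)}-\mathbf Q^*\|_F^{\mathbf w}\le C\beta^k$ for all $k$ and $t\ge e_k$; 2. if every player updates in every window of $B$ consecutive times and $t-\tau^q_r(t)<B$ at all its updates ($r\ne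 q$), then $\|\mathbf Q^{(t)}-\mathbf Q^*\|_F^{\mathbf w}\le C\beta^{\lfloor t/(2B)\rfloor}$ for all $t$; 3. for the synchronous schedule ($\mathcal T_q=\mathbb N$, $\tau^q_r(t)=t$), $\|\mathbf Q^{(t)}-\mathbf Q^*\|_F^{\mathbf w}\le C\beta^{t}$ for all $t$; 4. for the sequential schedule (the players update cyclically, one at each time, with $\tau^q_r(t)=t$), $\|\mathbf Q^{(t)}-\mathbf Q^*\|_F^{\mathbf w}\le C\beta^{\lfloor t/N\rfloor}$ for all $t$. -/

import Mathlib

open scoped Matrix ComplexOrder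

namespace EEGame

/-- A profile of strategies: one square complex matrix per player, of size `d q` for player `q`. -/
abbrev Profile {N : ℕ} (d : Fin N → ℕ) := (q : Fin N) → Matrix (Fin (d q)) (Fin (d q)) ℂ

/-- The data of a MIMO interfering network with `N` transmitter-receiver pairs; `nT q` and `nR q`
are the numbers of transmit and receive dimensions of pair `q`. `H q r` is the channel from
transmitter `r` to receiver `q`, `noise q` the noise covariance at receiver `q`, `P q` the maximum
power and `Ψ q` the circuitry power of transmitter `q`. -/
structure Network {N : ℕ} (nT nR : Fin N → ℕ) where
  H : (q r : Fin N) → Matrix (Fin (nR q)) (Fin (nT r)) ℂ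
  noise : (q : Fin N) → Matrix (Fin (nR q)) (Fin (nR q)) ℂ
  P : Fin N → ℝ
  Ψ : Fin N → ℝ

/-- `A = U diag(σ) Vᴴ` is a compact singular value decomposition: `U`, `V` are semi-unitary and all
`r` singular values are positive (so that `r` is the rank of `A`). -/
structure IsCompactSVD {m n r : ℕ} (A : Matrix (Fin m) (Fin n) ℂ) (U : Matrix (Fin m) (Fin r) ℂ)
    (σ : Fin r → ℝ) (V : Matrix (Fin n) (Fin r) ℂ) : Prop where
  left : Uᴴ * U = 1
  right : Vᴴ * V = 1
  pos : ∀ i, 0 < σ i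
  eq : A = U * Matrix.diagonal (fun i => (σ i : ℂ)) * Vᴴ

section norms

open scoped Matrix.Norms.Frobenius in
/-- The weighted block-maximum norm `max_q ‖A_q‖_F / w_q` (Frobenius norm of each block). -/
noncomputable def blockNorm {N : ℕ} {d : Fin N → ℕ} (w : Fin N → ℝ) (A : Profile d) : ℝ :=
  ⨆ q, ‖A q‖ / w q

/-- The weighted maximum norm `max_q |u_q| / w_q` of a real vector. -/
noncomputable def vecNorm {N : ℕ} (w : Fin N → ℝ) (u : Fin N → ℝ) : ℝ :=
  ⨆ q, |u q| / w q

open scoped Matrix.Norms.L2Operator in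
/-- The maximum singular value: the operator norm with respect to the Euclidean norms. -/
noncomputable def sigmaMax {m n : ℕ} (A : Matrix (Fin m) (Fin n) ℂ) : ℝ := ‖A‖

/-- The spectral radius of a real matrix: the maximum modulus of its complex eigenvalues. -/
noncomputable def specRadius {N : ℕ} (S : Matrix (Fin N) (Fin N) ℝ) : ℝ :=
  (spectralRadius ℂ (S.map (fun x : ℝ => (x : ℂ)))).toReal

end norms

namespace Network

variable {N : ℕ} {nT nR : Fin N → ℕ}

/-- Interference-plus-noise covariance at receiver `q`. -/
noncomputable def mui (G : Network nT nR) (q : Fin N) (Q : Profile nT) :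
    Matrix (Fin (nR q)) (Fin (nR q)) ℂ :=
  G.noise q + ∑ r ∈ Finset.univ.erase q, G.H q r * Q r * (G.H q r)ᴴ

/-- `H_qqᴴ R_q⁻¹ H_qq`. -/
noncomputable def gain (G : Network nT nR) (q : Fin N) (Q : Profile nT) :
    Matrix (Fin (nT q)) (Fin (nT q)) ℂ :=
  (G.H q q)ᴴ * (G.mui q Q)⁻¹ * G.H q q

/-- The rate of player `q` (the determinant is a positive real number on covariance matrices). -/
noncomputable def rate (G : Network nT nR) (q : Fin N) (Q : Profile nT) : ℝ :=
  Real.log (1 + G.gain q Q * Q q).det.re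

/-- The energy efficiency of player `q`. -/
noncomputable def ee (G : Network nT nR) (q : Fin N) (Q : Profile nT) : ℝ :=
  G.rate q Q / (G.Ψ q + (Q q).trace.re)

/-- Strategy set of player `q`: positive semidefinite matrices of trace at most `P q`. -/
def strat (G : Network nT nR) (q : Fin N) : Set (Matrix (Fin (nT q)) (Fin (nT q)) ℂ) :=
  {X | X.PosSemidef ∧ X.trace.re ≤ G.P q}

/-- Strategies of player `q` that use all the available power. -/
def fullStrat (G : Network nT nR) (q : Fin N) : Set (Matrix (Fin (nT q)) (Fin (nT q)) ℂ) :=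
  {X | X.PosSemidef ∧ X.trace.re = G.P q}

/-- Product of the strategy sets. -/
def profiles (G : Network nT nR) : Set (Profile nT) := {Q | ∀ q, Q q ∈ G.strat q}

/-- Product of the full-power strategy sets. -/
def fullProfiles (G : Network nT nR) : Set (Profile nT) := {Q | ∀ q, Q q ∈ G.fullStrat q}

/-- The set of best responses of player `q` to the strategies of the others in `Q`. It does not
depend on the block `Q q`. -/
def bestResponse (G : Network nT nR) (q : Fin N) (Q : Profile nT) :
    Set (Matrix (Fin (nT q)) (Fin (nT q)) ℂ) :=
  {X | X ∈ G.strat q ∧ IsMaxOn (fun Y => G.ee q (Function.update Q q Y)) (G.strat q) X}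

/-- Nash equilibria: every strategy is a best response to the others. -/
def IsNash (G : Network nT nR) (Q : Profile nT) : Prop := ∀ q, Q q ∈ G.bestResponse q Q

/-- The network in which transmitter `r` is restricted to the signals `V r x`: every channel
`H q r` is replaced by `H q r * V r`. -/
noncomputable def reduced (G : Network nT nR) {r : Fin N → ℕ}
    (V : (q : Fin N) → Matrix (Fin (nT q)) (Fin (r q)) ℂ) : Network r nR where
  H := fun q s => G.H q s * V s
  noise := G.noise
  P := G.P
  Ψ := G.Ψ

/-- Maximizers of the energy efficiency of player `q` without the maximum power constraint. -/
def unconstrainedArgmax (G : Network nT nR) (q : Fin N) (Q : Profile nT) :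
    Set (Matrix (Fin (nT q)) (Fin (nT q)) ℂ) :=
  {X | X.PosSemidef ∧
    IsMaxOn (fun Y => G.ee q (Function.update Q q Y)) {Y | Y.PosSemidef} X}

/-- The trace of the unconstrained maximizer. It is used for networks whose direct channels have
full column rank; the maximizer then exists and is unique, and the supremum is over one number. -/
noncomputable def unconstrainedPower (G : Network nT nR) (q : Fin N) (Q : Profile nT) : ℝ :=
  sSup ((fun X => X.trace.re) '' G.unconstrainedArgmax q Q)

/-- The power mapping. -/
noncomputable def power (G : Network nT nR) (Q : Profile nT) : Fin N → ℝ :=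
  fun q => min (G.P q) (G.unconstrainedPower q Q)

/-- `(H_qqᴴ R_q⁻¹ H_qq)⁻¹ H_qqᴴ R_q⁻¹ H_qr`, with `R_q` evaluated at the profile `Δ`. -/
noncomputable def gmat (G : Network nT nR) (q r : Fin N) (Δ : Profile nT) :
    Matrix (Fin (nT q)) (Fin (nT r)) ℂ :=
  (G.gain q Δ)⁻¹ * (G.H q q)ᴴ * (G.mui q Δ)⁻¹ * G.H q r

/-- The interference matrix: off the diagonal, the maximum over `Δ ∈ D` of the squared maximum
singular value of `gmat q r Δ`; zero on the diagonal. -/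
noncomputable def interference (G : Network nT nR) (D : Set (Profile nT)) :
    Matrix (Fin N) (Fin N) ℝ :=
  Matrix.of fun q r =>
    if r = q then 0 else sSup ((fun Δ => sigmaMax (G.gmat q r Δ) ^ 2) '' D)

end Network

/-- An update schedule: `updates q` is the set of times at which player `q` updates its strategy,
and `meas q r t` is the time at which the interference of player `r` that is used by player `q` at
time `t` was measured. -/
structure Schedule (N : ℕ) where
  updates : Fin N → Set ℕ
  meas : Fin N → Fin N → ℕ → ℕ
  meas_le : ∀ q r t, meas q r t ≤ t

namespace Schedule

variable {N : ℕ}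

/-- Total asynchronism: every player updates infinitely often, and every piece of information is
eventually purged from the system. -/
def IsTotallyAsync (s : Schedule N) : Prop :=
  (∀ q, (s.updates q).Infinite) ∧
  ∀ q r, r ≠ q → ∀ m, ∃ t₀, ∀ t ∈ s.updates q, t₀ ≤ t → m ≤ s.meas q r t

/-- Asynchronism bounded by `B`: every player updates in every window of `B` consecutive times, and
uses only measurements that are less than `B` steps old. -/
def IsPartiallyAsync (s : Schedule N) (B : ℕ) : Prop :=
  (∀ q t, ∃ u ∈ s.updates q, t ≤ u ∧ u < t + B) ∧
  ∀ q r, r ≠ q → ∀ t ∈ s.updates q, t < s.meas q r t + B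

/-- `e 0 = 0, e 1, e 2, …` delimit update rounds: in the round from `e k` to `e (k + 1)` there is a
time `a` from which on only information measured at or after `e k` is used, and every player updates
at least once between `a` and the end of the round. -/
def IsRoundSeq (s : Schedule N) (e : ℕ → ℕ) : Prop :=
  e 0 = 0 ∧ ∀ k, ∃ a, e k ≤ a ∧
    (∀ q r, r ≠ q → ∀ t ∈ s.updates q, a ≤ t → e k ≤ s.meas q r t) ∧
    ∀ q, ∃ t ∈ s.updates q, a ≤ t ∧ t < e (k + 1)

/-- All players update at all times, with current information. -/
def synchronous (N : ℕ) : Schedule N where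
  updates := fun _ => Set.univ
  meas := fun _ _ t => t
  meas_le := fun _ _ _ => le_rfl

/-- The players update one after the other, in cyclic order, with current information. -/
def sequential (N : ℕ) : Schedule N where
  updates := fun q => {t | t % N = (q : ℕ)}
  meas := fun _ _ t => t
  meas_le := fun _ _ _ => le_rfl

end Schedule

/-- `Q 0, Q 1, …` is a run of the energy-efficient iterative waterfilling algorithm under the
schedule `s`, from an admissible profile: at its update times player `q` plays a best response to
the measured strategies of the others, and otherwise it keeps its strategy. -/
def IsRun {N : ℕ} {nT nR : Fin N → ℕ} (G : Network nT nR) (s : Schedule N)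
    (Q : ℕ → Profile nT) : Prop :=
  Q 0 ∈ G.profiles ∧
  (∀ q, ∀ t ∈ s.updates q,
    Q (t + 1) q ∈ G.bestResponse q (fun r => Q (s.meas q r t) r)) ∧
  ∀ q, ∀ t ∉ s.updates q, Q (t + 1) q = Q t q

end EEGame

/-! In the reduced game the best response is unique: it is the waterfilling `X` on the noise
spectrum `C`, the inverse of the gain, with the power given by the power mapping
(`exists_userEE_maximizers`, `Network.exists_bestResponse`). The heart of the proof is that the
strict inequality of the contraction condition yields a uniform contraction factor.

Let `d` be the weighted distance of two profiles, scaled by `w q`, and let `W` be the waterfilling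
on the second noise spectrum with the first power. Then `X - X'` is the sum of `X - W` and `W - X'`.
The first term is traceless and, waterfilling at fixed power being a projection, has norm at most
`‖C - C'‖ ≤ ρ d`. The second is semidefinite up to sign, so its norm is at most its absolute trace,
which is at most `(1 - ρ) d`. The triangle inequality gives only the factor `1`, but a traceless and
a semidefinite matrix make an angle whose cosine is at most `√(1 - 1/n)`, so the factor drops below
`1` when `0 < ρ < 1` (`norm_add_sq_le_of_trace_eq_zero`, `IsAdmissible.exists_contraction`). If `ρ =
0`, the gains, and with them the best responses, are constant.

The bound on `C - C'` comes from an exact identity (`inv_gain_sub`) whose coefficients are the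
matrices in the interference matrix. Maximizing over full-power profiles suffices because, direction
by direction, unused power can be spent invisibly (`exists_fullProfiles_gmat_mulVec_eq`).

Power outside the row space of the direct channel costs energy and brings no rate, so all best
responses of the original game live on that row space. After its first update every player therefore
plays in the reduced game, whose contraction shrinks the error once per round
(`Schedule.IsRoundSeq.le_pow`). An equilibrium is a limit of iterated best responses; it is unique
because any equilibrium is a constant run. -/

namespace EEGame

/-! ### Frobenius geometry -/

section Frobenius

open scoped Matrix.Norms.Frobenius

variable {m n l k : Type*} [Fintype m] [Fintype n] [Fintype l] [Fintype k]

/-- The entries of a matrix as a vector of a Euclidean space. -/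
def frobVec (A : Matrix m n ℂ) : EuclideanSpace ℂ (m × n) := WithLp.toLp 2 (fun p => A p.1 p.2)

lemma norm_frobVec (A : Matrix m n ℂ) : ‖frobVec A‖ = ‖A‖ := by
  rw [EuclideanSpace.norm_eq, Matrix.frobenius_norm_def, Real.sqrt_eq_rpow, Fintype.sum_prod_type]
  simp [frobVec]

lemma inner_frobVec (A B : Matrix m n ℂ) :
    inner ℂ (frobVec A) (frobVec B) = (Aᴴ * B).trace := by
  rw [EuclideanSpace.inner_eq_star_dotProduct]
  simp only [frobVec, dotProduct, Fintype.sum_prod_type, Matrix.trace, Matrix.diag, Matrix.mul_apply,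
    Matrix.conjTranspose_apply, Pi.star_apply]
  rw [Finset.sum_comm]
  simp [mul_comm]

lemma frobenius_sq (A : Matrix m n ℂ) : ‖A‖ ^ 2 = (Aᴴ * A).trace.re := by
  rw [← norm_frobVec, ← inner_frobVec, ← inner_self_eq_norm_sq (𝕜 := ℂ)]
  rfl

lemma abs_trace_mul_le (A B : Matrix m n ℂ) : |(Aᴴ * B).trace.re| ≤ ‖A‖ * ‖B‖ := by
  rw [← norm_frobVec A, ← norm_frobVec B, ← inner_frobVec]
  exact (Complex.abs_re_le_norm _).trans (norm_inner_le_norm _ _)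

lemma trace_conjTranspose_mul_comm_re (A B : Matrix m n ℂ) :
    (Aᴴ * B).trace.re = (Bᴴ * A).trace.re := by
  rw [← inner_frobVec, ← inner_frobVec]
  exact inner_re_symm (𝕜 := ℂ) _ _

lemma norm_add_sq_frobenius (A B : Matrix m n ℂ) :
    ‖A + B‖ ^ 2 = ‖A‖ ^ 2 + 2 * (Aᴴ * B).trace.re + ‖B‖ ^ 2 := by
  simp only [frobenius_sq, Matrix.conjTranspose_add, Matrix.add_mul, Matrix.mul_add,
    Matrix.trace_add, Complex.add_re]
  rw [trace_conjTranspose_mul_comm_re B A]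
  ring

lemma norm_entry_le (A : Matrix m n ℂ) (i : m) (j : n) : ‖A i j‖ ≤ ‖A‖ := by
  rw [← norm_frobVec]
  exact PiLp.norm_apply_le (frobVec A) (i, j)

/-- A traceless matrix and a matrix whose norm is at most its trace are far from parallel. -/
lemma norm_add_sq_le_of_trace_eq_zero [DecidableEq n] [Nonempty n] {T Z : Matrix n n ℂ}
    (hT : T.trace = 0) (hZ : ‖Z‖ ≤ |Z.trace.re|) :
    ‖T + Z‖ ^ 2 ≤ ‖T‖ ^ 2 + ‖Z‖ ^ 2 +
      2 * (√(1 - 1 / (Fintype.card n : ℝ)) * (‖T‖ * ‖Z‖)) := by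
  have hn : (0 : ℝ) < Fintype.card n := by exact_mod_cast Fintype.card_pos
  -- Removing the scalar part of `Z` does not change its inner product with the traceless `T`, and
  -- lowers `‖Z‖ ^ 2` by `(tr Z) ^ 2 / n ≥ ‖Z‖ ^ 2 / n`. Cauchy–Schwarz for `T` and the remainder
  -- `Z₀` then gives the cosine.
  set c : ℝ := Z.trace.re / Fintype.card n with hc
  set Z₀ : Matrix n n ℂ := Z + (((-c : ℝ) : ℂ)) • (1 : Matrix n n ℂ) with hZ₀
  have h1 : (Tᴴ * Z).trace.re = (Tᴴ * Z₀).trace.re := by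
    simp [hZ₀, Matrix.mul_add, Matrix.trace_add, Matrix.trace_conjTranspose, hT]
  have h2 : ‖Z₀‖ ^ 2 ≤ (1 - 1 / (Fintype.card n : ℝ)) * ‖Z‖ ^ 2 := by
    rw [hZ₀, norm_add_sq_frobenius, frobenius_sq ((((-c : ℝ) : ℂ)) • (1 : Matrix n n ℂ))]
    have : (Zᴴ * ((((-c : ℝ) : ℂ)) • (1 : Matrix n n ℂ))).trace.re = - c * Z.trace.re := by
      simp [Matrix.trace_conjTranspose]
    rw [this]
    have : (((((-c : ℝ) : ℂ)) • (1 : Matrix n n ℂ))ᴴ *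
        ((((-c : ℝ) : ℂ)) • (1 : Matrix n n ℂ))).trace.re = c ^ 2 * Fintype.card n := by
      simp [Matrix.conjTranspose_smul, Matrix.trace_one]
      ring
    rw [this]
    have h3 : ‖Z‖ ^ 2 ≤ Z.trace.re ^ 2 := by
      rw [← sq_abs Z.trace.re]
      gcongr
    have h4 : c * Fintype.card n = Z.trace.re := by rw [hc]; field_simp
    have h5 : c * Z.trace.re = Z.trace.re ^ 2 / Fintype.card n := by rw [hc]; ring
    have h6 : ‖Z‖ ^ 2 / Fintype.card n ≤ Z.trace.re ^ 2 / Fintype.card n := by gcongr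
    have h7 : c ^ 2 * Fintype.card n = Z.trace.re ^ 2 / Fintype.card n := by
      rw [← h5, ← h4]; ring
    rw [h7]
    have : (1 - 1 / (Fintype.card n : ℝ)) * ‖Z‖ ^ 2 = ‖Z‖ ^ 2 - ‖Z‖ ^ 2 / Fintype.card n := by ring
    rw [this]
    linarith
  have h8 : ‖Z₀‖ ≤ √(1 - 1 / (Fintype.card n : ℝ)) * ‖Z‖ := by
    rw [← Real.sqrt_sq (norm_nonneg Z₀), ← Real.sqrt_sq (norm_nonneg Z), ← Real.sqrt_mul' _ (sq_nonneg _)]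
    exact Real.sqrt_le_sqrt h2
  have h9 := (le_abs_self _).trans (abs_trace_mul_le T Z₀)
  have h10 : ‖T‖ * ‖Z₀‖ ≤ ‖T‖ * (√(1 - 1 / (Fintype.card n : ℝ)) * ‖Z‖) := by gcongr
  rw [norm_add_sq_frobenius, h1]
  nlinarith

end Frobenius

/-! ### Traces of positive semidefinite matrices -/

section PosSemidef

variable {m n : Type*} [Fintype m] [Fintype n]

lemma exists_eq_conjTranspose_mul_self [DecidableEq n] {A : Matrix n n ℂ} (hA : A.PosSemidef) :
    ∃ B : Matrix n n ℂ, A = Bᴴ * B := by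
  open scoped MatrixOrder in
  exact CStarAlgebra.nonneg_iff_eq_star_mul_self.mp hA.nonneg

lemma trace_mul_nonneg [DecidableEq n] {A B : Matrix n n ℂ} (hA : A.PosSemidef)
    (hB : B.PosSemidef) : 0 ≤ (A * B).trace.re := by
  obtain ⟨D, rfl⟩ := exists_eq_conjTranspose_mul_self hB
  rw [← Matrix.mul_assoc, Matrix.trace_mul_comm, ← Matrix.mul_assoc]
  exact (Complex.le_def.1 (hA.mul_mul_conjTranspose_same D).trace_nonneg).1

lemma trace_re_nonneg {A : Matrix n n ℂ} (hA : A.PosSemidef) : 0 ≤ A.trace.re :=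
  (Complex.le_def.1 hA.trace_nonneg).1

lemma trace_im_eq_zero {A : Matrix n n ℂ} (hA : A.IsHermitian) : A.trace.im = 0 := by
  have h := Matrix.trace_conjTranspose A
  rw [hA.eq] at h
  exact Complex.conj_eq_iff_im.mp h.symm

lemma eq_zero_of_trace_re_nonpos {A : Matrix n n ℂ} (hA : A.PosSemidef) (h : A.trace.re ≤ 0) :
    A = 0 := by
  classical
  refine hA.trace_eq_zero_iff.mp (Complex.ext ?_ (trace_im_eq_zero hA.1))
  exact le_antisymm h (trace_re_nonneg hA)

-- Writing `A = Bᴴ * B`, submultiplicativity gives `‖A‖ ≤ ‖B‖ ^ 2 = tr A`.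
open scoped Matrix.Norms.Frobenius in
lemma frobenius_le_trace {A : Matrix n n ℂ} (hA : A.PosSemidef) : ‖A‖ ≤ A.trace.re := by
  classical
  obtain ⟨B, rfl⟩ := exists_eq_conjTranspose_mul_self hA
  rw [← frobenius_sq]
  refine (Matrix.frobenius_norm_mul _ _).trans_eq ?_
  rw [Matrix.frobenius_norm_conjTranspose, sq]

end PosSemidef

/-! ### Strict concavity of log det -/

section LogDet

variable {n : Type*} [Fintype n] [DecidableEq n]

lemma det_eq_ofReal_re {M : Matrix n n ℂ} (hM : M.PosDef) : M.det = (M.det.re : ℂ) := by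
  have := Complex.le_def.1 hM.det_pos.le
  exact Complex.ext rfl this.2.symm

lemma det_re_pos {M : Matrix n n ℂ} (hM : M.PosDef) : 0 < M.det.re :=
  (Complex.lt_def.1 hM.det_pos).1

lemma det_ne_zero_of_posDef {M : Matrix n n ℂ} (hM : M.PosDef) : M.det ≠ 0 := hM.det_pos.ne'

lemma isUnit_det_of_posDef {M : Matrix n n ℂ} (hM : M.PosDef) : IsUnit M.det :=
  isUnit_iff_ne_zero.mpr (det_ne_zero_of_posDef hM)

/-- This is `log x ≤ x - 1`, summed over the eigenvalues; equality forces every eigenvalue to be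
`1`. It is the tangent inequality at the identity. -/
lemma log_det_le_trace_sub_card {M : Matrix n n ℂ} (hM : M.PosDef) :
    Real.log M.det.re ≤ M.trace.re - Fintype.card n ∧
      (Real.log M.det.re = M.trace.re - Fintype.card n → M = 1) := by
  have hpos := hM.eigenvalues_pos
  have hdet : M.det.re = ∏ i, hM.1.eigenvalues i := by
    rw [hM.1.det_eq_prod_eigenvalues]
    simp [← Complex.ofReal_prod]
  have htr : M.trace.re = ∑ i, hM.1.eigenvalues i := by
    rw [hM.1.trace_eq_sum_eigenvalues]
    simp
  have hrhs : M.trace.re - Fintype.card n = ∑ i, (hM.1.eigenvalues i - 1) := by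
    rw [htr]; simp
  rw [hdet, hrhs, Real.log_prod (fun i _ => (hpos i).ne')]
  have hle : ∀ i ∈ Finset.univ, Real.log (hM.1.eigenvalues i) ≤ hM.1.eigenvalues i - 1 :=
    fun i _ => Real.log_le_sub_one_of_pos (hpos i)
  refine ⟨Finset.sum_le_sum hle, fun h => ?_⟩
  have h1 : ∀ i, hM.1.eigenvalues i = 1 := by
    intro i
    by_contra hi
    exact (Real.log_lt_sub_one_of_pos (hpos i) hi).ne ((Finset.sum_eq_sum_iff_of_le hle).mp h i
      (Finset.mem_univ i))
  have h2 := hM.1.spectral_theorem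
  rw [show (RCLike.ofReal ∘ hM.1.eigenvalues : n → ℂ) = fun _ => 1 by ext i; simp [h1 i],
    Matrix.diagonal_one, map_one] at h2
  exact h2

/-- The tangent inequality of the strictly concave function `log det`. -/
lemma log_det_sub_le {M M' : Matrix n n ℂ} (hM : M.PosDef) (hM' : M'.PosDef) :
    Real.log M'.det.re - Real.log M.det.re ≤ (M⁻¹ * (M' - M)).trace.re ∧
      (Real.log M'.det.re - Real.log M.det.re = (M⁻¹ * (M' - M)).trace.re → M' = M) := by
  obtain ⟨B, hB⟩ := exists_eq_conjTranspose_mul_self hM.posSemidef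
  have hdM : M.det = star B.det * B.det := by rw [hB, Matrix.det_mul, Matrix.det_conjTranspose]
  have hBu : IsUnit B.det := by
    rw [isUnit_iff_ne_zero]
    intro h
    exact det_ne_zero_of_posDef hM (by rw [hdM, h, mul_zero])
  have hBu' : IsUnit Bᴴ.det := by rw [Matrix.det_conjTranspose]; exact hBu.star
  have hinj : Function.Injective (B⁻¹).mulVec :=
    Matrix.mulVec_injective_iff_isUnit.mpr
      ((Matrix.isUnit_iff_isUnit_det _).mpr (Matrix.isUnit_nonsing_inv_det B hBu))
  have hN := hM'.conjTranspose_mul_mul_same hinj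
  -- The congruence by `B⁻¹`, where `M = Bᴴ * B`, moves `M` to the identity and `M'` to `K`.
  set K := (B⁻¹)ᴴ * M' * B⁻¹ with hK
  have hKB : Bᴴ * K * B = M' := by
    rw [hK, Matrix.conjTranspose_nonsing_inv]
    simp only [Matrix.mul_assoc]
    rw [Matrix.nonsing_inv_mul _ hBu, Matrix.mul_one, Matrix.mul_nonsing_inv_cancel_left _ _ hBu']
  have hdK : M'.det = M.det * K.det := by
    rw [← hKB, hdM, Matrix.det_mul, Matrix.det_mul, Matrix.det_conjTranspose]; ring
  have hlog : Real.log M'.det.re - Real.log M.det.re = Real.log K.det.re := by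
    rw [hdK, det_eq_ofReal_re hM, Complex.re_ofReal_mul, Complex.ofReal_re,
      Real.log_mul (det_re_pos hM).ne' (det_re_pos hN).ne']
    ring
  have hMinv : M⁻¹ = B⁻¹ * (B⁻¹)ᴴ := by
    rw [hB, Matrix.mul_inv_rev, Matrix.conjTranspose_nonsing_inv]
  have htr : (M⁻¹ * (M' - M)).trace.re = K.trace.re - Fintype.card n := by
    rw [Matrix.mul_sub, Matrix.nonsing_inv_mul _ (isUnit_det_of_posDef hM), Matrix.trace_sub,
      Matrix.trace_one, Complex.sub_re, Complex.natCast_re, hMinv, Matrix.mul_assoc,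
      Matrix.trace_mul_comm]
  obtain ⟨h1, h2⟩ := log_det_le_trace_sub_card hN
  rw [hlog, htr]
  refine ⟨h1, fun h => ?_⟩
  rw [← hKB, h2 h, Matrix.mul_one, ← hB]

end LogDet

/-! ### Functions of a Hermitian matrix -/

section ConjDiag

variable {n : Type*} [Fintype n] [DecidableEq n] {C : Matrix n n ℂ}

/-- The Hermitian matrix with eigenvalues `f` in the eigenbasis of `C`. -/
noncomputable def conjDiag (hC : C.IsHermitian) (f : n → ℝ) : Matrix n n ℂ :=
  (hC.eigenvectorUnitary : Matrix n n ℂ) * Matrix.diagonal (fun i => (f i : ℂ)) *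
    (hC.eigenvectorUnitary : Matrix n n ℂ)ᴴ

variable (hC : C.IsHermitian) (f g : n → ℝ)

lemma eigenvectorUnitary_conjTranspose_mul :
    (hC.eigenvectorUnitary : Matrix n n ℂ)ᴴ * (hC.eigenvectorUnitary : Matrix n n ℂ) = 1 :=
  Unitary.coe_star_mul_self hC.eigenvectorUnitary

lemma eigenvectorUnitary_mul_conjTranspose :
    (hC.eigenvectorUnitary : Matrix n n ℂ) * (hC.eigenvectorUnitary : Matrix n n ℂ)ᴴ = 1 :=
  Unitary.coe_mul_star_self hC.eigenvectorUnitary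

lemma conjDiag_eigenvalues : conjDiag hC hC.eigenvalues = C := by
  conv_rhs => rw [hC.spectral_theorem]
  rfl

lemma conjDiag_const (a : ℝ) : conjDiag hC (fun _ => a) = (a : ℂ) • 1 := by
  rw [conjDiag, ← Matrix.smul_one_eq_diagonal, Matrix.mul_smul, Matrix.smul_mul, Matrix.mul_one,
    eigenvectorUnitary_mul_conjTranspose]

lemma conjDiag_add : conjDiag hC f + conjDiag hC g = conjDiag hC (fun i => f i + g i) := by
  simp only [conjDiag, ← Matrix.add_mul, ← Matrix.mul_add, Matrix.diagonal_add, Complex.ofReal_add]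

lemma conjDiag_sub : conjDiag hC f - conjDiag hC g = conjDiag hC (fun i => f i - g i) := by
  simp only [conjDiag, ← Matrix.sub_mul, ← Matrix.mul_sub, Matrix.diagonal_sub, Complex.ofReal_sub]

lemma conjDiag_mul : conjDiag hC f * conjDiag hC g = conjDiag hC (fun i => f i * g i) := by
  simp only [conjDiag, Complex.ofReal_mul, ← Matrix.diagonal_mul_diagonal]
  simp only [Matrix.mul_assoc]
  rw [← Matrix.mul_assoc (hC.eigenvectorUnitary : Matrix n n ℂ)ᴴ,
    eigenvectorUnitary_conjTranspose_mul, Matrix.one_mul]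

lemma conjDiag_zero : conjDiag hC (fun _ => 0) = 0 := by
  rw [conjDiag_const]; simp

lemma trace_conjDiag : (conjDiag hC f).trace.re = ∑ i, f i := by
  rw [conjDiag, Matrix.trace_mul_comm, ← Matrix.mul_assoc, eigenvectorUnitary_conjTranspose_mul,
    Matrix.one_mul, Matrix.trace_diagonal]
  simp

lemma det_conjDiag : (conjDiag hC f).det.re = ∏ i, f i := by
  rw [conjDiag, Matrix.det_mul_comm, ← Matrix.mul_assoc, eigenvectorUnitary_conjTranspose_mul,
    Matrix.one_mul, Matrix.det_diagonal]
  simp [← Complex.ofReal_prod]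

lemma posSemidef_conjDiag (hf : ∀ i, 0 ≤ f i) : (conjDiag hC f).PosSemidef := by
  refine Matrix.PosSemidef.mul_mul_conjTranspose_same ?_ _
  rw [Matrix.posSemidef_diagonal_iff]
  exact fun i => by exact_mod_cast hf i

open scoped Matrix.Norms.Frobenius in
/-- Hermitian matrices with the same eigenbasis and ordered eigenvalues. -/
lemma frobenius_conjDiag_sub_le (h : (∀ i, f i ≤ g i) ∨ ∀ i, g i ≤ f i) :
    ‖conjDiag hC f - conjDiag hC g‖ ≤ |(conjDiag hC f - conjDiag hC g).trace.re| := by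
  rcases h with h | h
  · rw [norm_sub_rev, ← neg_sub (conjDiag hC g), Matrix.trace_neg, Complex.neg_re, abs_neg,
      conjDiag_sub]
    exact (frobenius_le_trace (posSemidef_conjDiag hC _ fun i => sub_nonneg.2 (h i))).trans
      (le_abs_self _)
  · rw [conjDiag_sub]
    exact (frobenius_le_trace (posSemidef_conjDiag hC _ fun i => sub_nonneg.2 (h i))).trans
      (le_abs_self _)

end ConjDiag

/-! ### Waterfilling -/

section Waterfill

variable {n : Type*} [Fintype n] [DecidableEq n]

/-- `X` and `C + X - ν` are the positive and negative parts of `ν - C`: the matrix `X` pours power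
on the noise spectrum of `C` up to the water level `ν`. -/
structure IsWaterfill (C X : Matrix n n ℂ) (ν : ℝ) : Prop where
  posSemidef : X.PosSemidef
  slack : (C + X - (ν : ℂ) • 1).PosSemidef
  slack_mul : (C + X - (ν : ℂ) • 1) * X = 0

/-- The waterfilling matrix in the eigenbasis of `C`. -/
noncomputable def waterfill {C : Matrix n n ℂ} (hC : C.IsHermitian) (ν : ℝ) : Matrix n n ℂ :=
  conjDiag hC (fun i => max (ν - hC.eigenvalues i) 0)

lemma add_waterfill {C : Matrix n n ℂ} (hC : C.IsHermitian) (ν : ℝ) :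
    C + waterfill hC ν = conjDiag hC (fun i => max ν (hC.eigenvalues i)) := by
  conv_lhs => enter [1]; rw [← conjDiag_eigenvalues hC]
  rw [waterfill, conjDiag_add]
  congr 1
  ext i
  rw [← max_add_add_left]
  simp

lemma isWaterfill_waterfill {C : Matrix n n ℂ} (hC : C.IsHermitian) (ν : ℝ) :
    IsWaterfill C (waterfill hC ν) ν := by
  have h : C + waterfill hC ν - (ν : ℂ) • 1 =
      conjDiag hC (fun i => max ν (hC.eigenvalues i) - ν) := by
    rw [add_waterfill, ← conjDiag_const hC, conjDiag_sub]
  refine ⟨posSemidef_conjDiag _ _ fun i => le_max_right _ _, ?_, ?_⟩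
  · rw [h]
    exact posSemidef_conjDiag _ _ fun i => sub_nonneg.2 (le_max_left _ _)
  · rw [h, waterfill, conjDiag_mul, ← conjDiag_zero hC]
    congr 1
    ext i
    rcases le_total ν (hC.eigenvalues i) with h' | h' <;> simp [h']

lemma trace_waterfill {C : Matrix n n ℂ} (hC : C.IsHermitian) (ν : ℝ) :
    (waterfill hC ν).trace.re = ∑ i, max (ν - hC.eigenvalues i) 0 := trace_conjDiag _ _

namespace IsWaterfill

open scoped Matrix.Norms.Frobenius

variable {C C' X X' : Matrix n n ℂ} {ν ν' : ℝ}

/-- With slacks `S`, `S'` one has `X = S - C + ν`. Pairing the difference of the two such identities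
with `X - X'`, complementary slackness kills `X * S` and `X' * S'`, and the cross terms `-tr (X *
S')` and `-tr (X' * S)` are nonpositive. -/
lemma norm_sub_sq_le (h : IsWaterfill C X ν) (h' : IsWaterfill C' X' ν') :
    ‖X - X'‖ ^ 2 ≤ -((X - X')ᴴ * (C - C')).trace.re +
      (ν - ν') * (X.trace.re - X'.trace.re) := by
  set S := C + X - (ν : ℂ) • (1 : Matrix n n ℂ) with hS
  set S' := C' + X' - (ν' : ℂ) • (1 : Matrix n n ℂ) with hS'
  have hX : (X - X')ᴴ = X - X' := (h.posSemidef.1.sub h'.posSemidef.1).eq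
  have hXS : X * S = 0 := by
    have := congrArg Matrix.conjTranspose h.slack_mul
    rwa [Matrix.conjTranspose_mul, h.posSemidef.1.eq, h.slack.1.eq, Matrix.conjTranspose_zero]
      at this
  have hXS' : X' * S' = 0 := by
    have := congrArg Matrix.conjTranspose h'.slack_mul
    rwa [Matrix.conjTranspose_mul, h'.posSemidef.1.eq, h'.slack.1.eq, Matrix.conjTranspose_zero]
      at this
  have e1 : X - X' = S - S' - (C - C') + ((ν - ν' : ℝ) : ℂ) • 1 := by
    rw [hS, hS', Complex.ofReal_sub, sub_smul]; abel
  have e2 : ‖X - X'‖ ^ 2 = ((X - X') * (S - S')).trace.re - ((X - X') * (C - C')).trace.re +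
      (ν - ν') * (X.trace.re - X'.trace.re) := by
    rw [frobenius_sq, hX]
    conv_lhs => enter [1, 1, 2]; rw [e1]
    rw [Matrix.mul_add, Matrix.mul_sub, Matrix.trace_add, Matrix.trace_sub, Matrix.mul_smul,
      Matrix.mul_one, Matrix.trace_smul, Matrix.trace_sub (A := X), Complex.add_re, Complex.sub_re,
      smul_eq_mul, Complex.re_ofReal_mul, Complex.sub_re]
  have e3 : ((X - X') * (S - S')).trace.re = -(X * S').trace.re - (X' * S).trace.re := by
    rw [Matrix.sub_mul, Matrix.mul_sub X S S', Matrix.mul_sub X' S S', hXS, hXS']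
    simp only [Matrix.trace_sub, Complex.sub_re, Matrix.trace_zero, Complex.zero_re]
    ring
  have h1 := trace_mul_nonneg h.posSemidef h'.slack
  have h2 := trace_mul_nonneg h'.posSemidef h.slack
  rw [← hS'] at h1
  rw [← hS] at h2
  rw [e2, hX, e3]
  linarith

lemma eq_of_level_eq (h : IsWaterfill C X ν) (h' : IsWaterfill C X' ν) : X = X' := by
  have := h.norm_sub_sq_le h'
  simp only [sub_self, Matrix.mul_zero, Matrix.trace_zero, Complex.zero_re, neg_zero, zero_mul,
    add_zero] at this
  rw [← sub_eq_zero, ← norm_eq_zero]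
  exact pow_eq_zero_iff two_ne_zero |>.mp (le_antisymm this (sq_nonneg _))

/-- Waterfilling at a fixed power is nonexpansive: it is a Frobenius projection. -/
lemma norm_sub_le (h : IsWaterfill C X ν) (h' : IsWaterfill C' X' ν')
    (htr : X.trace.re = X'.trace.re) : ‖X - X'‖ ≤ ‖C - C'‖ := by
  have h1 := h.norm_sub_sq_le h'
  rw [htr, sub_self, mul_zero, add_zero] at h1
  have h2 := (neg_le_abs _).trans (abs_trace_mul_le (X - X') (C - C'))
  rcases (norm_nonneg (X - X')).eq_or_lt with h0 | h0
  · rw [← h0]; exact norm_nonneg _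
  · refine le_of_mul_le_mul_left ?_ h0
    rw [← sq]
    exact h1.trans h2

/-- Waterfillings on the same noise spectrum at two levels are ordered. -/
lemma norm_sub_le_abs_trace (h : IsWaterfill C X ν) (h' : IsWaterfill C X' ν')
    (hC : C.IsHermitian) : ‖X - X'‖ ≤ |(X - X').trace.re| := by
  rw [h.eq_of_level_eq (isWaterfill_waterfill hC ν), h'.eq_of_level_eq (isWaterfill_waterfill hC ν')]
  refine frobenius_conjDiag_sub_le hC _ _ ?_
  rcases le_total ν ν' with hν | hν
  · exact Or.inl fun i => max_le_max_right _ (sub_le_sub_right hν _)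
  · exact Or.inr fun i => max_le_max_right _ (sub_le_sub_right hν _)

/-- Waterfilling maximizes the rate minus the cost of the power at price `1 / ν`. -/
lemma log_det_sub_le (h : IsWaterfill C X ν) (hC : C.PosDef) (hν : 0 < ν) {Y : Matrix n n ℂ}
    (hY : Y.PosSemidef) :
    Real.log (C + Y).det.re - Real.log (C + X).det.re ≤ (Y.trace.re - X.trace.re) / ν ∧
      (Real.log (C + Y).det.re - Real.log (C + X).det.re = (Y.trace.re - X.trace.re) / ν →
        Y = X) := by
  set M := C + X with hM
  have hMpd : M.PosDef := hC.add_posSemidef h.posSemidef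
  have hMu := isUnit_det_of_posDef hMpd
  obtain ⟨h1, h2⟩ := EEGame.log_det_sub_le hMpd (hC.add_posSemidef hY)
  set S := M - (ν : ℂ) • (1 : Matrix n n ℂ) with hS
  have hMS : M = S + (ν : ℂ) • (1 : Matrix n n ℂ) := by rw [hS]; abel
  have hνc : (ν : ℂ) ≠ 0 := by exact_mod_cast hν.ne'
  have hMX : M * X = (ν : ℂ) • X := by
    rw [hMS, Matrix.add_mul, h.slack_mul, zero_add, Matrix.smul_mul, Matrix.one_mul]
  have hMiX : M⁻¹ * X = ((ν⁻¹ : ℝ) : ℂ) • X := by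
    have := congrArg (fun Z => M⁻¹ * Z) hMX
    simp only [Matrix.nonsing_inv_mul_cancel_left _ _ hMu, Matrix.mul_smul] at this
    conv_rhs => rw [this]
    rw [smul_smul, Complex.ofReal_inv, inv_mul_cancel₀ hνc, one_smul]
  -- `S` commutes with `M = S + ν`, so `M⁻¹ * S` is the congruence of `S * M = S² + ν S` by `M⁻¹`.
  -- As `M⁻¹ * S = 1 - ν M⁻¹`, the marginal rate is at most `1 / ν` in every direction; `hMiX` says
  -- that it is equal to `1 / ν` on the range of `X`.
  have hK : (M⁻¹ * S).PosSemidef := by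
    have e : M⁻¹ * S = M⁻¹ * (S * Sᴴ + (ν : ℂ) • S) * (M⁻¹)ᴴ := by
      have : S * Sᴴ + (ν : ℂ) • S = S * M := by
        rw [h.slack.1.eq]
        conv_rhs => enter [2]; rw [hMS]
        rw [Matrix.mul_add, Matrix.mul_smul, Matrix.mul_one]
      rw [this, hMpd.inv.1.eq, Matrix.mul_assoc, Matrix.mul_nonsing_inv_cancel_right _ _ hMu]
    rw [e]
    exact ((Matrix.posSemidef_self_mul_conjTranspose S).add
      (h.slack.smul (by exact_mod_cast hν.le))).mul_mul_conjTranspose_same _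
  have e1 : M⁻¹ * S = 1 - (ν : ℂ) • M⁻¹ := by
    rw [hS, Matrix.mul_sub, Matrix.nonsing_inv_mul _ hMu, Matrix.mul_smul, Matrix.mul_one]
  have h3 : ν * (M⁻¹ * Y).trace.re ≤ Y.trace.re := by
    have := trace_mul_nonneg hK hY
    rw [e1, Matrix.sub_mul, Matrix.one_mul, Matrix.smul_mul, Matrix.trace_sub, Matrix.trace_smul,
      Complex.sub_re, smul_eq_mul, Complex.re_ofReal_mul] at this
    linarith
  have h4 : (M⁻¹ * (C + Y - M)).trace.re ≤ (Y.trace.re - X.trace.re) / ν := by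
    have : C + Y - M = Y - X := by rw [hM]; abel
    rw [this, Matrix.mul_sub, hMiX, Matrix.trace_sub, Matrix.trace_smul, Complex.sub_re,
      smul_eq_mul, Complex.re_ofReal_mul, sub_div, div_eq_inv_mul X.trace.re]
    refine sub_le_sub_right ?_ _
    rw [le_div_iff₀ hν]
    linarith
  refine ⟨h1.trans h4, fun heq => ?_⟩
  have := h2 (le_antisymm h1 (heq ▸ h4))
  rw [hM] at this
  exact add_left_cancel this

end IsWaterfill

end Waterfill

/-! ### Maximizers of the energy efficiency of one user -/

section EnergyEfficiency

variable {n : Type*} [Fintype n] [DecidableEq n]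

/-- The rate of a single user with channel gain matrix `A`. -/
noncomputable def userRate (A X : Matrix n n ℂ) : ℝ := Real.log (1 + A * X).det.re

/-- The energy efficiency of a single user with channel gain matrix `A`. -/
noncomputable def userEE (Ψ : ℝ) (A X : Matrix n n ℂ) : ℝ := userRate A X / (Ψ + X.trace.re)

lemma userRate_zero (A : Matrix n n ℂ) : userRate A 0 = 0 := by simp [userRate]

lemma userEE_zero (Ψ : ℝ) (A : Matrix n n ℂ) : userEE Ψ A 0 = 0 := by
  simp [userEE, userRate_zero]

/-- Since `1 + A Y = A (A⁻¹ + Y)`, the inverse gain is the noise spectrum for waterfilling. -/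
lemma userRate_eq {A Y : Matrix n n ℂ} (hA : A.PosDef) (hY : Y.PosSemidef) :
    userRate A Y = Real.log A.det.re + Real.log (A⁻¹ + Y).det.re := by
  have hpd := hA.inv.add_posSemidef hY
  have : 1 + A * Y = A * (A⁻¹ + Y) := by
    rw [Matrix.mul_add, Matrix.mul_nonsing_inv _ (isUnit_det_of_posDef hA)]
  rw [userRate, this, Matrix.det_mul, det_eq_ofReal_re hA, Complex.re_ofReal_mul,
    Complex.ofReal_re, Real.log_mul (det_re_pos hA).ne' (det_re_pos hpd).ne']

lemma IsWaterfill.userRate_sub_le {A X : Matrix n n ℂ} {ν : ℝ} (h : IsWaterfill A⁻¹ X ν)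
    (hA : A.PosDef) (hν : 0 < ν) {Y : Matrix n n ℂ} (hY : Y.PosSemidef) :
    userRate A Y - userRate A X ≤ (Y.trace.re - X.trace.re) / ν ∧
      (userRate A Y - userRate A X = (Y.trace.re - X.trace.re) / ν → Y = X) := by
  rw [userRate_eq hA hY, userRate_eq hA h.posSemidef, add_sub_add_left_eq_sub]
  exact h.log_det_sub_le hA.inv hν hY

lemma userRate_waterfill {A : Matrix n n ℂ} (hA : A.PosDef) (ν : ℝ) :
    userRate A (waterfill hA.inv.1 ν) =
      ∑ i, (Real.log (max ν (hA.inv.1.eigenvalues i)) - Real.log (hA.inv.1.eigenvalues i)) := by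
  have hpos := hA.inv.eigenvalues_pos
  -- The vanishing rate at `0` determines the constant `log det A` through the eigenvalues of `A⁻¹`.
  have h0 := userRate_eq hA (Matrix.PosSemidef.zero (n := n) (R := ℂ))
  have hdet : (A⁻¹).det.re = ∏ i, hA.inv.1.eigenvalues i := by
    conv_lhs => rw [← conjDiag_eigenvalues hA.inv.1]
    rw [det_conjDiag]
  rw [userRate_zero, add_zero, hdet, Real.log_prod (fun i _ => (hpos i).ne')] at h0
  rw [userRate_eq hA (isWaterfill_waterfill _ _).posSemidef, add_waterfill, det_conjDiag,
    Real.log_prod (fun i _ => (lt_max_of_lt_right (hpos i)).ne'), Finset.sum_sub_distrib]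
  linarith

lemma continuous_userRate_waterfill {A : Matrix n n ℂ} (hA : A.PosDef) :
    Continuous fun ν => userRate A (waterfill hA.inv.1 ν) := by
  rw [show (fun ν => userRate A (waterfill hA.inv.1 ν)) = _ from
    funext fun ν => userRate_waterfill hA ν]
  refine continuous_finsetSum _ fun i _ => Continuous.sub (Continuous.log (by fun_prop) fun ν => ?_)
    continuous_const
  exact (lt_max_of_lt_right (hA.inv.eigenvalues_pos i)).ne'

lemma continuous_trace_waterfill {C : Matrix n n ℂ} (hC : C.IsHermitian) :
    Continuous fun ν => (waterfill hC ν).trace.re := by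
  simp only [trace_waterfill]
  fun_prop

lemma waterfill_eq_zero {C : Matrix n n ℂ} (hC : C.IsHermitian) {ν : ℝ}
    (h : ∀ i, ν ≤ hC.eigenvalues i) : waterfill hC ν = 0 := by
  rw [waterfill, ← conjDiag_zero hC]
  congr 1
  ext i
  exact max_eq_right (sub_nonpos.2 (h i))

lemma exists_level_trace_eq [Nonempty n] {C : Matrix n n ℂ} (hC : C.PosDef) {p : ℝ}
    (hp : 0 ≤ p) : ∃ ν, (waterfill hC.1 ν).trace.re = p := by
  obtain ⟨i₀, hi₀⟩ := Finite.exists_min hC.1.eigenvalues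
  -- At the lowest eigenvalue nothing is poured; raising the level by `p` pours `p` on that
  -- eigenvector alone.
  suffices hmem : p ∈ Set.Icc (waterfill hC.1 (hC.1.eigenvalues i₀)).trace.re
      (waterfill hC.1 (hC.1.eigenvalues i₀ + p)).trace.re by
    obtain ⟨ν, -, hν⟩ := intermediate_value_Icc (by linarith)
      (continuous_trace_waterfill hC.1).continuousOn hmem
    exact ⟨ν, hν⟩
  refine ⟨?_, ?_⟩
  · rw [waterfill_eq_zero hC.1 hi₀]; simpa using hp
  · simp only [trace_waterfill]
    refine le_trans ?_ (Finset.single_le_sum (f := fun i =>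
      max (hC.1.eigenvalues i₀ + p - hC.1.eigenvalues i) 0) (fun i _ => le_max_right _ _)
      (Finset.mem_univ i₀))
    simp

/-- Some water level equates the marginal rate `1 / ν` with the energy efficiency. -/
lemma exists_level_userEE_eq [Nonempty n] {A : Matrix n n ℂ} (hA : A.PosDef) {Ψ : ℝ}
    (hΨ : 0 < Ψ) : ∃ ν, 0 < ν ∧
      userRate A (waterfill hA.inv.1 ν) = (Ψ + (waterfill hA.inv.1 ν).trace.re) / ν := by
  obtain ⟨i₀, hi₀⟩ := Finite.exists_min hA.inv.1.eigenvalues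
  set ev := hA.inv.1.eigenvalues with hev
  have hpos : ∀ i, 0 < ev i := hA.inv.eigenvalues_pos
  -- At the lowest eigenvalue the rate is `0`, below the positive cost. At level `b`, the
  -- exponential makes the rate at least `Ψ + n`, while `1 ≤ b` and trace at most `n b` keep the
  -- cost below `Ψ + n`.
  set b := max (max 1 (ev i₀)) (Real.exp (Real.log (ev i₀) + (Ψ + Fintype.card n))) with hb
  have hab : ev i₀ ≤ b := (le_max_right _ _).trans (le_max_left _ _)
  have hb1 : 1 ≤ b := (le_max_left _ _).trans (le_max_left _ _)
  have hcont : ContinuousOn (fun ν => userRate A (waterfill hA.inv.1 ν) -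
      (Ψ + (waterfill hA.inv.1 ν).trace.re) / ν) (Set.Icc (ev i₀) b) := by
    refine (continuous_userRate_waterfill hA).continuousOn.sub
      (ContinuousOn.div (continuous_const.add (continuous_trace_waterfill _)).continuousOn
        continuousOn_id fun ν hν => ((hpos i₀).trans_le hν.1).ne')
  suffices hmem : (0 : ℝ) ∈ Set.Icc
      (userRate A (waterfill hA.inv.1 (ev i₀)) - (Ψ + (waterfill hA.inv.1 (ev i₀)).trace.re) / ev i₀)
      (userRate A (waterfill hA.inv.1 b) - (Ψ + (waterfill hA.inv.1 b).trace.re) / b) by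
    obtain ⟨ν, hν, h0⟩ := intermediate_value_Icc hab hcont hmem
    exact ⟨ν, (hpos i₀).trans_le hν.1, sub_eq_zero.mp h0⟩
  refine ⟨?_, ?_⟩
  · rw [waterfill_eq_zero _ hi₀, userRate_zero]
    have : 0 < Ψ / ev i₀ := div_pos hΨ (hpos i₀)
    simp only [Matrix.trace_zero, Complex.zero_re, add_zero]
    linarith
  · have hbpos : 0 < b := by linarith
    have h1 : Real.log b - Real.log (ev i₀) ≤ userRate A (waterfill hA.inv.1 b) := by
      rw [userRate_waterfill hA, ← hev]
      refine le_trans ?_ (Finset.single_le_sum (f := fun i =>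
        Real.log (max b (ev i)) - Real.log (ev i)) (fun i _ => ?_) (Finset.mem_univ i₀))
      · simp [hab]
      · exact sub_nonneg.2 (Real.log_le_log (hpos i) (le_max_right _ _))
    have h2 : Real.log (ev i₀) + (Ψ + Fintype.card n) ≤ Real.log b := by
      rw [Real.le_log_iff_exp_le hbpos]
      exact le_max_right _ _
    have h3 : (Ψ + (waterfill hA.inv.1 b).trace.re) / b ≤ Ψ + Fintype.card n := by
      rw [div_le_iff₀ hbpos, trace_waterfill, ← hev, add_mul]
      refine add_le_add (le_mul_of_one_le_right hΨ.le hb1) ?_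
      refine (Finset.sum_le_card_nsmul Finset.univ _ b fun i _ => max_le ?_ hbpos.le).trans_eq ?_
      · linarith [hpos i]
      · simp [Finset.card_univ]
    linarith

/-- The energy efficiency has exactly one maximizer `X₀` without a power constraint and exactly one
maximizer `X` subject to it, which is the waterfilling of the power `min P (tr X₀)`. -/
theorem exists_userEE_maximizers [Nonempty n] {A : Matrix n n ℂ} (hA : A.PosDef) {Ψ P : ℝ}
    (hΨ : 0 < Ψ) (hP : 0 < P) :
    ∃ (X₀ X : Matrix n n ℂ) (ν : ℝ), X₀.PosSemidef ∧
      (∀ Y : Matrix n n ℂ, Y.PosSemidef →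
        userEE Ψ A Y ≤ userEE Ψ A X₀ ∧ (userEE Ψ A Y = userEE Ψ A X₀ → Y = X₀)) ∧
      IsWaterfill A⁻¹ X ν ∧ X.trace.re = min P X₀.trace.re ∧
      (∀ Y : Matrix n n ℂ, Y.PosSemidef → Y.trace.re ≤ P →
        userEE Ψ A Y ≤ userEE Ψ A X ∧ (userEE Ψ A Y = userEE Ψ A X → Y = X)) ∧
      0 < userRate A X := by
  obtain ⟨ν, hν, hνeq⟩ := exists_level_userEE_eq hA hΨ
  set X₀ := waterfill hA.inv.1 ν with hX₀
  have hW : IsWaterfill A⁻¹ X₀ ν := isWaterfill_waterfill _ _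
  have hden : ∀ Y : Matrix n n ℂ, Y.PosSemidef → 0 < Ψ + Y.trace.re :=
    fun Y hY => by linarith [trace_re_nonneg hY]
  have hEE₀ : userEE Ψ A X₀ = 1 / ν := by
    rw [userEE, hνeq]
    field_simp [(hden X₀ hW.posSemidef).ne']
  -- At this level the tangent bound at price `1 / ν` reads `userRate A Y ≤ (Ψ + tr Y) / ν`, and `1
  -- / ν` is the efficiency of `X₀`.
  have hmax₀ : ∀ Y : Matrix n n ℂ, Y.PosSemidef →
      userEE Ψ A Y ≤ userEE Ψ A X₀ ∧ (userEE Ψ A Y = userEE Ψ A X₀ → Y = X₀) := by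
    intro Y hY
    obtain ⟨h1, h2⟩ := hW.userRate_sub_le hA hν hY
    have e : (Y.trace.re - X₀.trace.re) / ν =
        1 / ν * (Ψ + Y.trace.re) - (Ψ + X₀.trace.re) / ν := by ring
    rw [hEE₀]
    refine ⟨?_, fun h => h2 ?_⟩
    · rw [userEE, div_le_iff₀ (hden Y hY)]
      rw [e] at h1
      linarith
    · rw [userEE, div_eq_iff (hden Y hY).ne'] at h
      rw [e]
      linarith
  refine ⟨X₀, ?_⟩
  rcases le_or_gt X₀.trace.re P with hle | hlt
  · refine ⟨X₀, ν, hW.posSemidef, hmax₀, hW, (min_eq_right hle).symm,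
      fun Y hY _ => hmax₀ Y hY, ?_⟩
    rw [hνeq]
    exact div_pos (hden _ hW.posSemidef) hν
  · obtain ⟨i₀, hi₀⟩ := Finite.exists_min hA.inv.1.eigenvalues
    have hi₀pos := hA.inv.eigenvalues_pos i₀
    have hi₀ν : hA.inv.1.eigenvalues i₀ ≤ ν := by
      by_contra! hcon
      have : X₀ = 0 := waterfill_eq_zero _ fun i => hcon.le.trans (hi₀ i)
      rw [this] at hlt
      simp at hlt
      linarith
    -- If `X₀` is too expensive, a level `μ < ν` pours exactly `P`. The efficiency there is at most
    -- `1 / ν < 1 / μ`, so using less power than `P` loses rate at a price above the efficiency.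
    obtain ⟨μ, hμ, hμP⟩ := intermediate_value_Icc hi₀ν
      (continuous_trace_waterfill hA.inv.1).continuousOn (show P ∈ Set.Icc _ _ from ⟨by
        rw [waterfill_eq_zero _ hi₀]; simpa using hP.le, hlt.le⟩)
    simp only at hμP
    have hμν : μ < ν := lt_of_le_of_ne hμ.2 fun h => by
      rw [h] at hμP
      exact hlt.ne' hμP
    have hμ0 : 0 < μ := hi₀pos.trans_le hμ.1
    set X := waterfill hA.inv.1 μ with hX
    have hWX : IsWaterfill A⁻¹ X μ := isWaterfill_waterfill _ _
    have hEEX : userEE Ψ A X < 1 / μ :=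
      ((hmax₀ X hWX.posSemidef).1.trans_eq hEE₀).trans_lt (one_div_lt_one_div_of_lt hμ0 hμν)
    have hrateX : userRate A X = userEE Ψ A X * (Ψ + P) := by
      rw [userEE, hμP, div_mul_cancel₀]
      linarith
    have hmax : ∀ Y : Matrix n n ℂ, Y.PosSemidef → Y.trace.re ≤ P →
        userEE Ψ A Y ≤ userEE Ψ A X ∧ (userEE Ψ A Y = userEE Ψ A X → Y = X) := by
      intro Y hY hYP
      obtain ⟨h1, h2⟩ := hWX.userRate_sub_le hA hμ0 hY
      rw [hμP, hrateX, div_eq_mul_one_div] at h1 h2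
      have h3 : (Y.trace.re - P) * (1 / μ) ≤ (Y.trace.re - P) * userEE Ψ A X :=
        mul_le_mul_of_nonpos_left hEEX.le (by linarith)
      refine ⟨?_, fun h => h2 (le_antisymm h1 ?_)⟩
      · rw [userEE, div_le_iff₀ (hden Y hY)]
        linarith
      · have : userRate A Y = userEE Ψ A X * (Ψ + Y.trace.re) := by
          rw [← h, userEE, div_mul_cancel₀ _ (hden Y hY).ne']
        rw [this]
        linarith
    refine ⟨X, μ, hW.posSemidef, hmax₀, hWX, by rw [hμP, min_eq_left hlt.le], hmax, ?_⟩
    -- Idleness has efficiency `0`, and uniqueness makes the optimum, which has trace `P > 0`,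
    -- strictly better.
    have h0 := hmax 0 Matrix.PosSemidef.zero (by simpa using hP.le)
    rw [userEE_zero] at h0
    have hEEpos : 0 < userEE Ψ A X := lt_of_le_of_ne h0.1 fun h => by
      have := h0.2 h
      rw [← this] at hμP
      simp at hμP
      exact hP.ne hμP
    rw [hrateX]
    exact mul_pos hEEpos (by linarith)

end EnergyEfficiency

/-! ### The maximum singular value -/

section SigmaMax

variable {m n l : ℕ}

lemma sigmaMax_nonneg (A : Matrix (Fin m) (Fin n) ℂ) : 0 ≤ sigmaMax A := by
  open scoped Matrix.Norms.L2Operator in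
  exact norm_nonneg A

lemma norm_mulVec_le_sigmaMax (A : Matrix (Fin m) (Fin n) ℂ) (x : Fin n → ℂ) :
    ‖WithLp.toLp 2 (A *ᵥ x)‖ ≤ sigmaMax A * ‖WithLp.toLp 2 x‖ := by
  open scoped Matrix.Norms.L2Operator in
  exact Matrix.l2_opNorm_mulVec A (WithLp.toLp 2 x)

lemma sigmaMax_conjTranspose (A : Matrix (Fin m) (Fin n) ℂ) : sigmaMax Aᴴ = sigmaMax A := by
  open scoped Matrix.Norms.L2Operator in
  exact Matrix.l2_opNorm_conjTranspose A

lemma sigmaMax_le {A : Matrix (Fin m) (Fin n) ℂ} {c : ℝ} (hc : 0 ≤ c)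
    (h : ∀ x : Fin n → ℂ, ‖WithLp.toLp 2 (A *ᵥ x)‖ ≤ c * ‖WithLp.toLp 2 x‖) : sigmaMax A ≤ c := by
  open scoped Matrix.Norms.L2Operator in
  change ‖A‖ ≤ c
  rw [Matrix.l2_opNorm_def]
  exact ContinuousLinearMap.opNorm_le_bound _ hc fun x => h x.ofLp

open scoped Matrix.Norms.Frobenius

lemma frobenius_sq_eq_sum_col (A : Matrix (Fin m) (Fin n) ℂ) :
    ‖A‖ ^ 2 = ∑ j, ‖WithLp.toLp 2 (fun i => A i j)‖ ^ 2 := by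
  rw [← norm_frobVec, EuclideanSpace.norm_sq_eq, Fintype.sum_prod_type, Finset.sum_comm]
  simp [EuclideanSpace.norm_sq_eq, frobVec]

lemma frobenius_mul_le (A : Matrix (Fin m) (Fin n) ℂ) (X : Matrix (Fin n) (Fin l) ℂ) :
    ‖A * X‖ ≤ sigmaMax A * ‖X‖ := by
  refine abs_le_of_sq_le_sq' ?_ (mul_nonneg (sigmaMax_nonneg A) (norm_nonneg _)) |>.2
  rw [mul_pow, frobenius_sq_eq_sum_col, frobenius_sq_eq_sum_col, Finset.mul_sum]
  refine Finset.sum_le_sum fun j _ => ?_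
  rw [← mul_pow]
  exact pow_le_pow_left₀ (norm_nonneg _) (norm_mulVec_le_sigmaMax A fun i => X i j) 2

lemma frobenius_mul_mul_conjTranspose_le (A : Matrix (Fin m) (Fin n) ℂ)
    (X : Matrix (Fin n) (Fin n) ℂ) (B : Matrix (Fin m) (Fin n) ℂ) :
    ‖A * X * Bᴴ‖ ≤ sigmaMax A * sigmaMax B * ‖X‖ := by
  have h1 : ‖X * Bᴴ‖ ≤ sigmaMax B * ‖X‖ := by
    rw [← Matrix.frobenius_norm_conjTranspose, Matrix.conjTranspose_mul,
      Matrix.conjTranspose_conjTranspose, ← Matrix.frobenius_norm_conjTranspose X]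
    exact frobenius_mul_le _ _
  rw [Matrix.mul_assoc, mul_assoc]
  exact (frobenius_mul_le _ _).trans (mul_le_mul_of_nonneg_left h1 (sigmaMax_nonneg A))

lemma sigmaMax_le_frobenius (A : Matrix (Fin m) (Fin n) ℂ) : sigmaMax A ≤ ‖A‖ := by
  refine sigmaMax_le (norm_nonneg A) fun x => ?_
  rw [← Matrix.frobenius_norm_replicateCol (ι := Fin 1), ← Matrix.frobenius_norm_replicateCol (ι := Fin 1),
    Matrix.replicateCol_mulVec]
  exact Matrix.frobenius_norm_mul _ _

end SigmaMax

/-! ### Waterfillings with different noise and power -/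

section Waterfill

open scoped Matrix.Norms.Frobenius

variable {n : ℕ}

/-- Two waterfillings differ by a traceless term, which is due to the noise spectra, and by a
semidefinite one, which is due to the powers. -/
lemma IsWaterfill.norm_sub_sq_le_of_power [NeZero n] {C C' X X' : Matrix (Fin n) (Fin n) ℂ}
    {ν ν' : ℝ} (h : IsWaterfill C X ν) (h' : IsWaterfill C' X' ν') (hC' : C'.PosDef)
    {a b : ℝ} (ha : 0 ≤ a) (haC : n = 1 ∨ ‖C - C'‖ ≤ a) (hb : |X.trace.re - X'.trace.re| ≤ b) :
    ‖X - X'‖ ^ 2 ≤ a ^ 2 + b ^ 2 + 2 * (√(1 - 1 / (n : ℝ)) * (a * b)) := by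
  -- `W` has the noise spectrum of `X'` and the power of `X`.
  obtain ⟨μ, hμ⟩ := exists_level_trace_eq hC' (trace_re_nonneg h.posSemidef)
  set W := waterfill hC'.1 μ with hW
  have hWf : IsWaterfill C' W μ := isWaterfill_waterfill _ _
  have hT : (X - W).trace = 0 := by
    refine Complex.ext ?_ (trace_im_eq_zero (h.posSemidef.1.sub hWf.posSemidef.1))
    rw [Matrix.trace_sub, Complex.sub_re, hμ, sub_self, Complex.zero_re]
  have hTa : ‖X - W‖ ≤ a := by
    -- A traceless matrix of size one vanishes, so no bound on the noise spectra is needed. This is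
    -- why players of rank one are exempt in the condition on `D`.
    rcases haC with h1 | h1
    · subst h1
      have : X - W = 0 := by
        ext i j
        rw [Matrix.trace_fin_one] at hT
        rw [Subsingleton.elim i 0, Subsingleton.elim j 0, hT]
        rfl
      rw [this, norm_zero]
      exact ha
    · exact (h.norm_sub_le hWf hμ.symm).trans h1
  have hZ := hWf.norm_sub_le_abs_trace h' hC'.1
  have hZb : ‖W - X'‖ ≤ b := by
    refine hZ.trans ?_
    rwa [Matrix.trace_sub, Complex.sub_re, hμ]
  have := norm_add_sq_le_of_trace_eq_zero hT hZ
  rw [sub_add_sub_cancel, Fintype.card_fin] at this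
  refine this.trans ?_
  gcongr

end Waterfill

/-! ### Spending the remaining power invisibly -/

section FullPower

variable {n : ℕ}

lemma exists_ne_zero_star_dotProduct_eq_zero [NeZero n] {z : Fin n → ℂ} (h : n ≠ 1 ∨ z = 0) :
    ∃ v : Fin n → ℂ, v ≠ 0 ∧ star v ⬝ᵥ z = 0 := by
  by_cases hz : z = 0
  · exact ⟨Pi.single 0 1, by simp, by simp [hz]⟩
  have hn : 1 < n := by
    have := NeZero.ne n
    have := h.resolve_right hz
    omega
  have h01 : (⟨0, by omega⟩ : Fin n) ≠ ⟨1, hn⟩ := by simp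
  generalize (⟨0, by omega⟩ : Fin n) = i at h01
  generalize (⟨1, hn⟩ : Fin n) = j at h01
  by_cases hi : z i = 0
  · exact ⟨Pi.single i 1, by simp, by simp [Pi.star_single, hi]⟩
  · refine ⟨Pi.single i (star (z j)) - Pi.single j (star (z i)), fun h0 => hi ?_, ?_⟩
    · have := congrFun h0 j
      simpa [h01.symm] using this
    · simp [Pi.star_single, star_sub, sub_dotProduct, mul_comm]

namespace Network

variable {N : ℕ} {nT nR : Fin N → ℕ} (G : Network nT nR)

/-- The remaining power can be spent on a rank-one term that does not affect a given vector. -/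
lemma exists_mem_fullStrat_mulVec_eq {q : Fin N} (hq : 0 < nT q)
    {X : Matrix (Fin (nT q)) (Fin (nT q)) ℂ} (hX : X ∈ G.strat q) {z : Fin (nT q) → ℂ}
    (h : nT q ≠ 1 ∨ z = 0) : ∃ X' ∈ G.fullStrat q, X' *ᵥ z = X *ᵥ z := by
  have : NeZero (nT q) := ⟨hq.ne'⟩
  obtain ⟨v, hv, hvz⟩ := exists_ne_zero_star_dotProduct_eq_zero h
  set K := Matrix.vecMulVec v (star v) with hK
  have hKpsd : K.PosSemidef := Matrix.posSemidef_vecMulVec_self_star v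
  have hK0 : K.trace.re ≠ 0 := fun h0 => hv <| by
    have h1 := eq_zero_of_trace_re_nonpos hKpsd h0.le
    ext i
    have := congrFun (congrFun h1 i) i
    simpa [hK, Matrix.vecMulVec_apply] using this
  have hKpos : 0 < K.trace.re := lt_of_le_of_ne (trace_re_nonneg hKpsd) hK0.symm
  set t := (G.P q - X.trace.re) / K.trace.re with ht
  have ht0 : 0 ≤ t := div_nonneg (sub_nonneg.2 hX.2) hKpos.le
  refine ⟨X + (t : ℂ) • K, ⟨hX.1.add (hKpsd.smul (by exact_mod_cast ht0)), ?_⟩, ?_⟩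
  · rw [Matrix.trace_add, Matrix.trace_smul, Complex.add_re, smul_eq_mul, Complex.re_ofReal_mul,
      ht, div_mul_cancel₀ _ hK0]
    ring
  · rw [Matrix.add_mulVec, Matrix.smul_mulVec, hK, Matrix.vecMulVec_mulVec, hvz]
    simp

end Network

end FullPower

/-! ### Best responses in regular networks -/

namespace Network

variable {N : ℕ} {nT nR : Fin N → ℕ}

/-- The standing assumptions on a network whose direct channels have full column rank. -/
structure IsRegular (G : Network nT nR) : Prop where
  noise_posDef : ∀ q, (G.noise q).PosDef
  P_pos : ∀ q, 0 < G.P q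
  Ψ_pos : ∀ q, 0 < G.Ψ q
  dim_pos : ∀ q, 0 < nT q
  injective : ∀ q, Function.Injective (G.H q q).mulVec

variable (G : Network nT nR)

lemma mui_congr {q : Fin N} {Q Q' : Profile nT} (h : ∀ r, r ≠ q → Q r = Q' r) :
    G.mui q Q = G.mui q Q' := by
  rw [mui, mui]
  congr 1
  exact Finset.sum_congr rfl fun r hr => by rw [h r (Finset.ne_of_mem_erase hr)]

lemma gain_congr {q : Fin N} {Q Q' : Profile nT} (h : ∀ r, r ≠ q → Q r = Q' r) :
    G.gain q Q = G.gain q Q' := by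
  rw [gain, gain, G.mui_congr h]

lemma gain_update (q : Fin N) (Q : Profile nT) (Y : Matrix (Fin (nT q)) (Fin (nT q)) ℂ) :
    G.gain q (Function.update Q q Y) = G.gain q Q :=
  G.gain_congr fun _ hr => Function.update_of_ne hr _ _

/-- The own strategy does not enter the own gain, so each player faces a single-user problem. -/
lemma ee_update (q : Fin N) (Q : Profile nT) (Y : Matrix (Fin (nT q)) (Fin (nT q)) ℂ) :
    G.ee q (Function.update Q q Y) = userEE (G.Ψ q) (G.gain q Q) Y := by
  rw [ee, rate, gain_update, Function.update_self]
  rfl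

variable {G}

lemma mui_posDef {q : Fin N} (hn : (G.noise q).PosDef) {Q : Profile nT}
    (hQ : ∀ r, r ≠ q → (Q r).PosSemidef) : (G.mui q Q).PosDef :=
  hn.add_posSemidef (Matrix.posSemidef_sum _ fun r hr =>
    (hQ r (Finset.ne_of_mem_erase hr)).mul_mul_conjTranspose_same _)

lemma gain_posDef (hG : G.IsRegular) {q : Fin N} {Q : Profile nT}
    (hQ : ∀ r, r ≠ q → (Q r).PosSemidef) : (G.gain q Q).PosDef :=
  (mui_posDef (hG.noise_posDef q) hQ).inv.conjTranspose_mul_mul_same (hG.injective q)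

lemma bestResponse_eq_singleton {q : Fin N} {Q : Profile nT}
    {X : Matrix (Fin (nT q)) (Fin (nT q)) ℂ} (hX : X ∈ G.strat q)
    (hmax : ∀ Y ∈ G.strat q, userEE (G.Ψ q) (G.gain q Q) Y ≤ userEE (G.Ψ q) (G.gain q Q) X ∧
      (userEE (G.Ψ q) (G.gain q Q) Y = userEE (G.Ψ q) (G.gain q Q) X → Y = X)) :
    G.bestResponse q Q = {X} := by
  ext Y
  simp only [bestResponse, Set.mem_ofPred_eq, Set.mem_singleton_iff, ee_update]
  constructor
  · rintro ⟨hY, hYmax⟩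
    exact (hmax Y hY).2 (le_antisymm (hmax Y hY).1 (hYmax hX))
  · rintro rfl
    exact ⟨hX, fun Z hZ => (hmax Z hZ).1⟩

/-- In a regular network the best response is unique, and it is the waterfilling of the power given
by the power mapping. -/
theorem exists_bestResponse (hG : G.IsRegular) {q : Fin N} {Q : Profile nT}
    (hQ : ∀ r, r ≠ q → (Q r).PosSemidef) :
    ∃ X ν, G.bestResponse q Q = {X} ∧ IsWaterfill (G.gain q Q)⁻¹ X ν ∧
      X.trace.re = G.power Q q := by
  have : NeZero (nT q) := ⟨(hG.dim_pos q).ne'⟩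
  obtain ⟨X₀, X, ν, hX₀, hmax₀, hW, htr, hmax, -⟩ :=
    exists_userEE_maximizers (gain_posDef hG hQ) (hG.Ψ_pos q) (hG.P_pos q)
  have hXP : X.trace.re ≤ G.P q := htr.trans_le (min_le_left _ _)
  refine ⟨X, ν, ?_, hW, ?_⟩
  · exact bestResponse_eq_singleton ⟨hW.posSemidef, hXP⟩ fun Y hY => hmax Y hY.1 hY.2
  · have : G.unconstrainedArgmax q Q = {X₀} := by
      ext Y
      simp only [unconstrainedArgmax, Set.mem_ofPred_eq, Set.mem_singleton_iff, ee_update]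
      constructor
      · rintro ⟨hY, hYmax⟩
        exact (hmax₀ Y hY).2 (le_antisymm (hmax₀ Y hY).1 (hYmax hX₀))
      · rintro rfl
        exact ⟨hX₀, fun Z hZ => (hmax₀ Z hZ).1⟩
    rw [htr, power, unconstrainedPower, this, Set.image_singleton, csSup_singleton]

/-! ### The linear receiver and the variation of the inverse gain -/

section Receiver

variable (G) in
/-- The linear receiver `(H_qqᴴ R_q⁻¹ H_qq)⁻¹ H_qqᴴ R_q⁻¹`. -/
noncomputable def receiver (q : Fin N) (Q : Profile nT) :
    Matrix (Fin (nT q)) (Fin (nR q)) ℂ :=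
  (G.gain q Q)⁻¹ * (G.H q q)ᴴ * (G.mui q Q)⁻¹

lemma gmat_eq (q r : Fin N) (Q : Profile nT) : G.gmat q r Q = G.receiver q Q * G.H q r := rfl

variable {q : Fin N} {Q Q' : Profile nT}

lemma receiver_mul (hG : G.IsRegular) (hQ : ∀ r, r ≠ q → (Q r).PosSemidef) :
    G.receiver q Q * G.H q q = 1 := by
  have := Matrix.nonsing_inv_mul _ (isUnit_det_of_posDef (gain_posDef hG hQ))
  rw [receiver]
  simpa only [gain, Matrix.mul_assoc] using this

lemma receiver_mul_mui (hG : G.IsRegular) (hQ : ∀ r, r ≠ q → (Q r).PosSemidef) :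
    G.receiver q Q * G.mui q Q = (G.gain q Q)⁻¹ * (G.H q q)ᴴ := by
  rw [receiver, Matrix.nonsing_inv_mul_cancel_right _ _
    (isUnit_det_of_posDef (mui_posDef (hG.noise_posDef q) hQ))]

lemma mui_mul_receiver (hG : G.IsRegular) (hQ : ∀ r, r ≠ q → (Q r).PosSemidef) :
    G.mui q Q * (G.receiver q Q)ᴴ = G.H q q * (G.gain q Q)⁻¹ := by
  have := congrArg Matrix.conjTranspose (receiver_mul_mui hG hQ)
  rwa [Matrix.conjTranspose_mul, Matrix.conjTranspose_mul, Matrix.conjTranspose_conjTranspose,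
    (mui_posDef (hG.noise_posDef q) hQ).1.eq, (gain_posDef hG hQ).inv.1.eq] at this

lemma mui_sub (q : Fin N) (Q Q' : Profile nT) :
    G.mui q Q - G.mui q Q' =
      ∑ r ∈ Finset.univ.erase q, G.H q r * (Q r - Q' r) * (G.H q r)ᴴ := by
  rw [mui, mui, add_sub_add_left_eq_sub, ← Finset.sum_sub_distrib]
  simp only [Matrix.mul_sub, Matrix.sub_mul]

/-- An exact form of the mean value theorem for `Q ↦ (H_qqᴴ R_q⁻¹ H_qq)⁻¹`. -/
lemma inv_gain_sub (hG : G.IsRegular) (hQ : ∀ r, r ≠ q → (Q r).PosSemidef)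
    (hQ' : ∀ r, r ≠ q → (Q' r).PosSemidef) :
    (G.gain q Q)⁻¹ - (G.gain q Q')⁻¹ =
      ∑ r ∈ Finset.univ.erase q, G.gmat q r Q' * (Q r - Q' r) * (G.gmat q r Q)ᴴ := by
  -- Each receiver absorbs its own covariance (`receiver_mul_mui`, `mui_mul_receiver`) and is a left
  -- inverse of the direct channel, which leaves only the two inverse gains.
  have h1 : G.receiver q Q' * (G.mui q Q - G.mui q Q') * (G.receiver q Q)ᴴ =
      (G.gain q Q)⁻¹ - (G.gain q Q')⁻¹ := by
    have h2 : (G.H q q)ᴴ * (G.receiver q Q)ᴴ = 1 := by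
      rw [← Matrix.conjTranspose_mul, receiver_mul hG hQ, Matrix.conjTranspose_one]
    rw [Matrix.mul_sub, Matrix.sub_mul, receiver_mul_mui hG hQ', Matrix.mul_assoc,
      mui_mul_receiver hG hQ, ← Matrix.mul_assoc, receiver_mul hG hQ', Matrix.one_mul,
      Matrix.mul_assoc, h2, Matrix.mul_one]
  rw [← h1, mui_sub, Matrix.mul_sum, Matrix.sum_mul]
  refine Finset.sum_congr rfl fun r _ => ?_
  simp only [gmat_eq, Matrix.conjTranspose_mul, Matrix.mul_assoc]

open scoped Matrix.Norms.Frobenius in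
lemma norm_inv_gain_sub_le (hG : G.IsRegular) (hQ : ∀ r, r ≠ q → (Q r).PosSemidef)
    (hQ' : ∀ r, r ≠ q → (Q' r).PosSemidef) :
    ‖(G.gain q Q)⁻¹ - (G.gain q Q')⁻¹‖ ≤
      ∑ r ∈ Finset.univ.erase q,
        sigmaMax (G.gmat q r Q') * sigmaMax (G.gmat q r Q) * ‖Q r - Q' r‖ := by
  rw [inv_gain_sub hG hQ hQ']
  exact norm_sum_le_of_le _ fun r _ => frobenius_mul_mul_conjTranspose_le _ _ _

/-- If one linear receiver cancels all the interference, then the interference does not matter. -/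
lemma gain_eq_of_gmat_eq_zero (hG : G.IsRegular) (hQ : ∀ r, r ≠ q → (Q r).PosSemidef)
    (hQ' : ∀ r, r ≠ q → (Q' r).PosSemidef) (h0 : ∀ r, r ≠ q → G.gmat q r Q = 0) :
    G.gain q Q' = G.gain q Q := by
  -- The receiver at `Q` does not see the difference of the covariances, so it is also built from
  -- the covariance at `Q'`; being a left inverse of the direct channel, it then identifies the two
  -- gains.
  have h1 : G.receiver q Q * G.mui q Q' = (G.gain q Q)⁻¹ * (G.H q q)ᴴ := by
    rw [← receiver_mul_mui hG hQ, ← sub_eq_zero, ← Matrix.mul_sub, mui_sub, Matrix.mul_sum]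
    refine Finset.sum_eq_zero fun r hr => ?_
    rw [← Matrix.mul_assoc, ← Matrix.mul_assoc, ← gmat_eq, h0 r (Finset.ne_of_mem_erase hr),
      Matrix.zero_mul, Matrix.zero_mul]
  have hu := isUnit_det_of_posDef (mui_posDef (hG.noise_posDef q) hQ')
  have h2 : G.receiver q Q = (G.gain q Q)⁻¹ * (G.H q q)ᴴ * (G.mui q Q')⁻¹ := by
    rw [← h1, Matrix.mul_nonsing_inv_cancel_right _ _ hu]
  have h3 : (G.gain q Q)⁻¹ * G.gain q Q' = 1 := by
    rw [← receiver_mul hG hQ, h2]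
    change (G.gain q Q)⁻¹ * ((G.H q q)ᴴ * (G.mui q Q')⁻¹ * G.H q q) = _
    simp only [Matrix.mul_assoc]
  have hu' := isUnit_det_of_posDef (gain_posDef hG hQ)
  rw [← Matrix.mul_nonsing_inv_cancel_left (A := G.gain q Q) (G.gain q Q') hu', h3, Matrix.mul_one]

/-- The receiver is a left inverse of a square direct channel, hence its inverse, whatever the
interference. -/
lemma gmat_eq_of_square (hG : G.IsRegular) (hQ : ∀ r, r ≠ q → (Q r).PosSemidef)
    (hQ' : ∀ r, r ≠ q → (Q' r).PosSemidef) (hq : nT q = nR q) (r : Fin N) :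
    G.gmat q r Q = G.gmat q r Q' := by
  have h1 : G.H q q * G.receiver q Q' = 1 :=
    (Matrix.mul_eq_one_comm_of_card_eq _ _ _ (by simp [hq])).mp (receiver_mul hG hQ')
  have h2 : G.receiver q Q = G.receiver q Q' := by
    rw [← Matrix.mul_one (G.receiver q Q), ← h1, ← Matrix.mul_assoc, receiver_mul hG hQ,
      Matrix.one_mul]
  rw [gmat_eq, gmat_eq, h2]

/-- The output of the receiver along a given direction is that of a full-power profile. -/
lemma exists_fullProfiles_gmat_mulVec_eq (hG : G.IsRegular) (hQ : Q ∈ G.profiles)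
    (h : ∀ s, s ≠ q → nT s ≠ 1) (u : Fin (nT q) → ℂ) :
    ∃ Q' ∈ G.fullProfiles, ∀ r, (G.gmat q r Q')ᴴ *ᵥ u = (G.gmat q r Q)ᴴ *ᵥ u := by
  -- The vector `y` is determined by `H_qqᴴ y = u` and `R_q y` in the range of `H_qq`. It suffices
  -- to keep `R_q y`, that is, the action of each `Q s` on the single vector `H_qsᴴ y`.
  set y := (G.receiver q Q)ᴴ *ᵥ u with hy
  have hex : ∀ s, ∃ X ∈ G.fullStrat s, s ≠ q →
      X *ᵥ ((G.H q s)ᴴ *ᵥ y) = Q s *ᵥ ((G.H q s)ᴴ *ᵥ y) := by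
    intro s
    by_cases hs : s = q
    -- The block of `q` itself does not enter `R_q`, so any full-power strategy serves, even in
    -- dimension one.
    · obtain ⟨X, hX, -⟩ := G.exists_mem_fullStrat_mulVec_eq (hG.dim_pos s) (hQ s)
        (z := 0) (Or.inr rfl)
      exact ⟨X, hX, fun h => absurd hs h⟩
    · obtain ⟨X, hX, hXz⟩ := G.exists_mem_fullStrat_mulVec_eq (hG.dim_pos s) (hQ s)
        (z := (G.H q s)ᴴ *ᵥ y) (Or.inl (h s hs))
      exact ⟨X, hX, fun _ => hXz⟩
  choose Q' hQ' hz using hex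
  have hQp : ∀ r, r ≠ q → (Q r).PosSemidef := fun r _ => (hQ r).1
  have hQp' : ∀ r, r ≠ q → (Q' r).PosSemidef := fun r _ => (hQ' r).1
  have hR : G.mui q Q' *ᵥ y = G.mui q Q *ᵥ y := by
    rw [← sub_eq_zero, ← Matrix.sub_mulVec, mui_sub, Matrix.sum_mulVec]
    refine Finset.sum_eq_zero fun s hs => ?_
    rw [← Matrix.mulVec_mulVec, ← Matrix.mulVec_mulVec, Matrix.sub_mulVec,
      hz s (Finset.ne_of_mem_erase hs), sub_self, Matrix.mulVec_zero]
  have hR2 : G.mui q Q' *ᵥ y = G.H q q *ᵥ ((G.gain q Q)⁻¹ *ᵥ u) := by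
    rw [hR, hy, Matrix.mulVec_mulVec, mui_mul_receiver hG hQp, Matrix.mulVec_mulVec]
  have hu := isUnit_det_of_posDef (mui_posDef (hG.noise_posDef q) hQp')
  have hu' := isUnit_det_of_posDef (gain_posDef hG hQp')
  have hy2 : y = (G.mui q Q')⁻¹ *ᵥ (G.H q q *ᵥ ((G.gain q Q)⁻¹ *ᵥ u)) := by
    rw [← hR2, Matrix.mulVec_mulVec, Matrix.nonsing_inv_mul _ hu, Matrix.one_mulVec]
  have hHy : (G.H q q)ᴴ *ᵥ y = u := by
    rw [hy, Matrix.mulVec_mulVec, ← Matrix.conjTranspose_mul, receiver_mul hG hQp,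
      Matrix.conjTranspose_one, Matrix.one_mulVec]
  have hgu : G.gain q Q' *ᵥ ((G.gain q Q)⁻¹ *ᵥ u) = u := by
    conv_rhs => rw [← hHy, hy2]
    simp only [gain, Matrix.mulVec_mulVec, Matrix.mul_assoc]
  have hgu' : (G.gain q Q)⁻¹ *ᵥ u = (G.gain q Q')⁻¹ *ᵥ u := by
    conv_rhs => rw [← hgu]
    rw [Matrix.mulVec_mulVec (M := (G.gain q Q')⁻¹), Matrix.nonsing_inv_mul _ hu', Matrix.one_mulVec]
  have hy' : (G.receiver q Q')ᴴ *ᵥ u = y := by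
    rw [hy2, hgu', Matrix.mulVec_mulVec (M := G.H q q), ← mui_mul_receiver hG hQp',
      Matrix.mulVec_mulVec, Matrix.nonsing_inv_mul_cancel_left _ _ hu]
  refine ⟨Q', hQ', fun r => ?_⟩
  rw [gmat_eq, gmat_eq, Matrix.conjTranspose_mul, Matrix.conjTranspose_mul,
    ← Matrix.mulVec_mulVec, ← Matrix.mulVec_mulVec, hy', hy]

end Receiver

end Network

/-! ### Weighted maximum norms -/

section BlockNorm

open scoped Matrix.Norms.Frobenius

variable {N : ℕ} {d : Fin N → ℕ} {w : Fin N → ℝ}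

lemma norm_le_blockNorm (hw : ∀ q, 0 < w q) (A : Profile d) (q : Fin N) :
    ‖A q‖ ≤ w q * blockNorm w A := by
  rw [mul_comm, ← div_le_iff₀ (hw q)]
  exact le_ciSup (f := fun q => ‖A q‖ / w q) (Set.finite_range _).bddAbove q

lemma blockNorm_nonneg (hw : ∀ q, 0 < w q) (A : Profile d) : 0 ≤ blockNorm w A :=
  Real.iSup_nonneg fun q => div_nonneg (norm_nonneg _) (hw q).le

lemma blockNorm_le (hw : ∀ q, 0 < w q) {A : Profile d} {c : ℝ} (hc : 0 ≤ c)
    (h : ∀ q, ‖A q‖ ≤ w q * c) : blockNorm w A ≤ c := by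
  refine Real.iSup_le (fun q => ?_) hc
  rw [div_le_iff₀ (hw q), mul_comm]
  exact h q

lemma abs_le_vecNorm (hw : ∀ q, 0 < w q) (u : Fin N → ℝ) (q : Fin N) :
    |u q| ≤ w q * vecNorm w u := by
  rw [mul_comm, ← div_le_iff₀ (hw q)]
  exact le_ciSup (f := fun q => |u q| / w q) (Set.finite_range _).bddAbove q

lemma vecNorm_nonneg (hw : ∀ q, 0 < w q) (u : Fin N → ℝ) : 0 ≤ vecNorm w u :=
  Real.iSup_nonneg fun q => div_nonneg (abs_nonneg _) (hw q).le

end BlockNorm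

namespace Network

variable {N : ℕ} {nT nR : Fin N → ℕ} {G : Network nT nR}

/-! ### Compactness and boundedness -/

section Compactness

open scoped Matrix.Norms.Frobenius in
lemma norm_le_of_mem_strat {q : Fin N} {X : Matrix (Fin (nT q)) (Fin (nT q)) ℂ}
    (hX : X ∈ G.strat q) : ‖X‖ ≤ G.P q := (frobenius_le_trace hX.1).trans hX.2

lemma isClosed_strat (q : Fin N) : IsClosed (G.strat q) := by
  refine IsClosed.inter (s₁ := {X : Matrix (Fin (nT q)) (Fin (nT q)) ℂ | X.PosSemidef}) ?_ ?_
  · simp only [Matrix.posSemidef_iff_dotProduct_mulVec, Set.ofPred_and, Set.ofPred_forall]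
    refine IsClosed.inter (isClosed_eq (by fun_prop) continuous_id) (isClosed_iInter fun x => ?_)
    exact isClosed_le continuous_const (by fun_prop)
  · exact isClosed_le (f := fun X : Matrix (Fin (nT q)) (Fin (nT q)) ℂ => X.trace.re)
      (g := fun _ => G.P q) (by fun_prop) continuous_const

lemma isCompact_strat (q : Fin N) : IsCompact (G.strat q) := by
  have hK : IsCompact (Set.univ.pi fun _ : Fin (nT q) => Set.univ.pi fun _ : Fin (nT q) =>
      Metric.closedBall (0 : ℂ) (G.P q)) :=
    isCompact_univ_pi fun _ => isCompact_univ_pi fun _ => isCompact_closedBall _ _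
  refine hK.of_isClosed_subset (isClosed_strat q) fun X hX i _ j _ => ?_
  rw [mem_closedBall_zero_iff]
  exact (norm_entry_le X i j).trans (norm_le_of_mem_strat hX)

variable (G) in
lemma isCompact_profiles : IsCompact G.profiles := by
  have : G.profiles = Set.univ.pi G.strat := by ext Q; simp [profiles]
  rw [this]
  exact isCompact_univ_pi isCompact_strat

lemma continuousOn_matrix_inv {α : Type*} [TopologicalSpace α] {n : ℕ} {s : Set α}
    {f : α → Matrix (Fin n) (Fin n) ℂ} (hf : ContinuousOn f s) (h0 : ∀ x ∈ s, (f x).det ≠ 0) :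
    ContinuousOn (fun x => (f x)⁻¹) s := by
  simp only [Matrix.inv_def, Ring.inverse_eq_inv']
  rw [continuousOn_iff_continuous_domRestrict] at hf ⊢
  refine Continuous.smul (Continuous.inv₀ (Continuous.matrix_det hf) fun x => h0 x x.2)
    (Continuous.matrix_adjugate hf)

lemma continuousOn_gmat (hG : G.IsRegular) (q r : Fin N) :
    ContinuousOn (G.gmat q r) G.profiles := by
  have hmui : Continuous (G.mui q) := by
    unfold mui
    fun_prop
  have h1 : ContinuousOn (fun Q => (G.mui q Q)⁻¹) G.profiles :=
    continuousOn_matrix_inv hmui.continuousOn fun Q hQ =>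
      det_ne_zero_of_posDef (mui_posDef (hG.noise_posDef q) fun r _ => (hQ r).1)
  have h2 : ContinuousOn (G.gain q) G.profiles := by
    unfold gain
    fun_prop
  have h3 : ContinuousOn (fun Q => (G.gain q Q)⁻¹) G.profiles :=
    continuousOn_matrix_inv h2 fun Q hQ =>
      det_ne_zero_of_posDef (gain_posDef hG fun r _ => (hQ r).1)
  unfold gmat
  fun_prop

/-- Without this bound the `sSup` in the interference matrix could be the default value `0`. The
squared Frobenius norm, a polynomial in real and imaginary parts of the entries, dominates and is
continuous on a compact set. -/
lemma bddAbove_sigmaMax_gmat (hG : G.IsRegular) (q r : Fin N) :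
    BddAbove ((fun Q => sigmaMax (G.gmat q r Q) ^ 2) '' G.profiles) := by
  have hc : ContinuousOn (fun Q => ∑ p : Fin (nT q) × Fin (nT r), ‖G.gmat q r Q p.1 p.2‖ ^ 2)
      G.profiles := by
    have := continuousOn_gmat hG q r
    refine continuousOn_finsetSum _ fun p _ => ContinuousOn.pow (ContinuousOn.norm ?_) 2
    exact (continuous_apply_apply p.1 p.2).comp_continuousOn this
  obtain ⟨K, hK⟩ := (isCompact_profiles G).bddAbove_image hc
  refine ⟨K, ?_⟩
  rintro _ ⟨Q, hQ, rfl⟩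
  refine le_trans ?_ (hK ⟨Q, hQ, rfl⟩)
  open scoped Matrix.Norms.Frobenius in
  refine (pow_le_pow_left₀ (sigmaMax_nonneg _) (sigmaMax_le_frobenius _) 2).trans_eq ?_
  rw [← norm_frobVec, EuclideanSpace.norm_sq_eq]
  rfl

end Compactness

/-! ### The interference matrix and the contraction -/

section Interference

variable {D : Set (Profile nT)}

lemma fullProfiles_subset_profiles : G.fullProfiles ⊆ G.profiles :=
  fun _ hQ q => ⟨(hQ q).1, (hQ q).2.le⟩

lemma zero_mem_profiles (hG : G.IsRegular) : (0 : Profile nT) ∈ G.profiles :=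
  fun q => ⟨Matrix.PosSemidef.zero, by simpa using (hG.P_pos q).le⟩

lemma fullProfiles_nonempty (hG : G.IsRegular) : G.fullProfiles.Nonempty := by
  have : ∀ q, ∃ X, X ∈ G.fullStrat q := fun q =>
    let ⟨X, hX, _⟩ := G.exists_mem_fullStrat_mulVec_eq (hG.dim_pos q) (zero_mem_profiles hG q)
      (z := 0) (Or.inr rfl)
    ⟨X, hX⟩
  choose X hX using this
  exact ⟨X, hX⟩

lemma interference_nonneg (q r : Fin N) : 0 ≤ G.interference D q r := by
  rw [interference, Matrix.of_apply]
  split_ifs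
  · exact le_rfl
  · refine Real.sSup_nonneg ?_
    rintro _ ⟨Q, -, rfl⟩
    exact sq_nonneg _

lemma sigmaMax_gmat_sq_le (hG : G.IsRegular) (hD : D ⊆ G.profiles) {q r : Fin N} (hr : r ≠ q)
    {Q : Profile nT} (hQ : Q ∈ D) : sigmaMax (G.gmat q r Q) ^ 2 ≤ G.interference D q r := by
  rw [interference, Matrix.of_apply, if_neg hr]
  exact le_csSup ((bddAbove_sigmaMax_gmat hG q r).mono (Set.image_mono hD)) ⟨Q, hQ, rfl⟩

variable (G D) in
/-- The sets over which the entries of the interference matrix may be maximized. -/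
def IsAdmissible : Prop :=
  (D = G.fullProfiles ∧ ∀ q s, s ≠ q → nT s = 1 → nT q = 1 ∨ nT q = nR q) ∨ D = G.profiles

lemma IsAdmissible.subset (hD : G.IsAdmissible D) : D ⊆ G.profiles := by
  rcases hD with ⟨rfl, -⟩ | rfl
  · exact fullProfiles_subset_profiles
  · exact subset_rfl

lemma IsAdmissible.nonempty (hD : G.IsAdmissible D) (hG : G.IsRegular) : D.Nonempty := by
  rcases hD with ⟨rfl, -⟩ | rfl
  · exact fullProfiles_nonempty hG
  · exact ⟨0, zero_mem_profiles hG⟩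

/-- Entries maximized over full-power profiles still bound all profiles. Either the receiver is
constant, or every interferer has dimension above one; then the adjoint acts on each vector `u` as
at some full-power profile, which may depend on `u`. -/
lemma IsAdmissible.sigmaMax_gmat_sq_le (hD : G.IsAdmissible D) (hG : G.IsRegular) {q r : Fin N}
    (hq : nT q ≠ 1) (hr : r ≠ q) {Q : Profile nT} (hQ : Q ∈ G.profiles) :
    sigmaMax (G.gmat q r Q) ^ 2 ≤ G.interference D q r := by
  have hsub := hD.subset
  obtain ⟨Q₁, hQ₁⟩ := hD.nonempty hG
  rcases hD with ⟨rfl, hdim⟩ | rfl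
  swap
  · exact Network.sigmaMax_gmat_sq_le hG hsub hr hQ
  by_cases hsq : nT q = nR q
  · rw [gmat_eq_of_square hG (fun r _ => (hQ r).1) (fun r _ => (hQ₁ r).1) hsq r]
    exact Network.sigmaMax_gmat_sq_le hG hsub hr hQ₁
  have hs : ∀ s, s ≠ q → nT s ≠ 1 := fun s hs h1 => (hdim q s hs h1).elim hq hsq
  have h0 := interference_nonneg (G := G) (D := G.fullProfiles) q r
  rw [← Real.sq_sqrt h0, ← sigmaMax_conjTranspose]
  refine pow_le_pow_left₀ (sigmaMax_nonneg _) (sigmaMax_le (Real.sqrt_nonneg _) fun u => ?_) 2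
  obtain ⟨Q', hQ', hu⟩ := exists_fullProfiles_gmat_mulVec_eq hG hQ hs u
  rw [← hu r]
  refine (norm_mulVec_le_sigmaMax _ u).trans (mul_le_mul_of_nonneg_right ?_ (norm_nonneg _))
  rw [sigmaMax_conjTranspose]
  exact Real.le_sqrt_of_sq_le (Network.sigmaMax_gmat_sq_le hG hsub hr hQ')

lemma sigmaMax_eq_zero {m n : ℕ} {A : Matrix (Fin m) (Fin n) ℂ} (h : sigmaMax A = 0) : A = 0 := by
  open scoped Matrix.Norms.L2Operator in
  exact norm_eq_zero.mp h

/-- Without interference in the sense of the interference matrix, the gains are constant. -/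
lemma IsAdmissible.gain_eq (hD : G.IsAdmissible D) (hG : G.IsRegular) {q : Fin N}
    (h0 : ∀ r, r ≠ q → G.interference D q r = 0) {Q Q' : Profile nT} (hQ : Q ∈ G.profiles)
    (hQ' : Q' ∈ G.profiles) : G.gain q Q = G.gain q Q' := by
  obtain ⟨Q₁, hQ₁⟩ := hD.nonempty hG
  have hz : ∀ r, r ≠ q → G.gmat q r Q₁ = 0 := fun r hr => by
    have := Network.sigmaMax_gmat_sq_le hG hD.subset hr hQ₁
    rw [h0 r hr] at this
    exact sigmaMax_eq_zero (pow_eq_zero_iff two_ne_zero |>.mp (le_antisymm this (sq_nonneg _)))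
  have hp : ∀ r, r ≠ q → (Q₁ r).PosSemidef := fun r _ => (hD.subset hQ₁ r).1
  rw [gain_eq_of_gmat_eq_zero hG hp (fun r _ => (hQ r).1) hz,
    gain_eq_of_gmat_eq_zero hG hp (fun r _ => (hQ' r).1) hz]

open scoped Matrix.Norms.Frobenius in
lemma IsAdmissible.norm_inv_gain_sub_le (hD : G.IsAdmissible D) (hG : G.IsRegular) {q : Fin N}
    (hq : nT q ≠ 1) {w : Fin N → ℝ} (hw : ∀ q, 0 < w q) {ρ : ℝ}
    (hPerron : (G.interference D).mulVec w = ρ • w) {Q Q' : Profile nT} (hQ : Q ∈ G.profiles)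
    (hQ' : Q' ∈ G.profiles) :
    ‖(G.gain q Q)⁻¹ - (G.gain q Q')⁻¹‖ ≤ ρ * (w q * blockNorm w (Q - Q')) := by
  have hrow : ∑ r, G.interference D q r * w r = ρ * w q := congrFun hPerron q
  have hd := blockNorm_nonneg hw (Q - Q')
  calc _ ≤ ∑ r ∈ Finset.univ.erase q,
        sigmaMax (G.gmat q r Q') * sigmaMax (G.gmat q r Q) * ‖Q r - Q' r‖ :=
        Network.norm_inv_gain_sub_le hG (fun r _ => (hQ r).1) (fun r _ => (hQ' r).1)
    _ ≤ ∑ r ∈ Finset.univ.erase q, G.interference D q r * (w r * blockNorm w (Q - Q')) := by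
        refine Finset.sum_le_sum fun r hr => ?_
        have hr' := Finset.ne_of_mem_erase hr
        have h1 := hD.sigmaMax_gmat_sq_le hG hq hr' hQ
        have h2 := hD.sigmaMax_gmat_sq_le hG hq hr' hQ'
        refine mul_le_mul ?_ (norm_le_blockNorm hw (Q - Q') r) (norm_nonneg _)
          (interference_nonneg q r)
        -- The product of the singular values at the two profiles is at most the mean of their
        -- squares.
        nlinarith [sq_nonneg (sigmaMax (G.gmat q r Q') - sigmaMax (G.gmat q r Q))]
    _ ≤ ∑ r, G.interference D q r * (w r * blockNorm w (Q - Q')) :=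
        Finset.sum_le_sum_of_subset_of_nonneg (Finset.erase_subset _ _) fun r _ _ =>
          mul_nonneg (interference_nonneg q r) (mul_nonneg (hw r).le hd)
    _ = ρ * (w q * blockNorm w (Q - Q')) := by
        rw [← mul_assoc, ← hrow, Finset.sum_mul]
        exact Finset.sum_congr rfl fun r _ => by ring

open scoped Matrix.Norms.Frobenius in
/-- Under the contraction condition the best response is a contraction, uniformly. -/
theorem IsAdmissible.exists_contraction [NeZero N] (hD : G.IsAdmissible D) (hG : G.IsRegular)
    {w : Fin N → ℝ} (hw : ∀ q, 0 < w q) {ρ : ℝ} (hρ : 0 ≤ ρ)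
    (hPerron : (G.interference D).mulVec w = ρ • w)
    (hcontr : ∀ Q ∈ G.profiles, ∀ Q' ∈ G.profiles, Q ≠ Q' →
      vecNorm w (G.power Q - G.power Q') < (1 - ρ) * blockNorm w (Q - Q')) :
    ∃ β : ℝ, 0 < β ∧ β < 1 ∧ ∀ Q ∈ G.profiles, ∀ Q' ∈ G.profiles, ∀ q,
      ∀ X ∈ G.bestResponse q Q, ∀ X' ∈ G.bestResponse q Q',
        ‖X - X'‖ ≤ β * (w q * blockNorm w (Q - Q')) := by
  -- Applied to a full-power profile and `0`, which differ, the condition makes `(1 - ρ)` times a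
  -- norm positive.
  have hρ1 : ρ < 1 := by
    obtain ⟨Q, hQ⟩ := fullProfiles_nonempty hG
    have hne : Q ≠ 0 := fun h0 => by
      have h1 := (hQ 0).2
      rw [h0] at h1
      simp only [Pi.zero_apply, Matrix.trace_zero, Complex.zero_re] at h1
      exact (hG.P_pos 0).ne h1
    have := (vecNorm_nonneg hw _).trans_lt
      (hcontr Q (fullProfiles_subset_profiles hQ) 0 (zero_mem_profiles hG) hne)
    by_contra! h
    exact this.not_ge (mul_nonpos_of_nonpos_of_nonneg (by linarith) (blockNorm_nonneg hw _))
  -- If `ρ = 0`, positivity of `w` makes the interference matrix vanish; the best response is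
  -- constant and any factor in `(0, 1)` serves.
  rcases hρ.eq_or_lt with h0 | hρ0
  · refine ⟨1 / 2, by norm_num, by norm_num, fun Q hQ Q' hQ' q X hX X' hX' => ?_⟩
    have hS : ∀ r, r ≠ q → G.interference D q r = 0 := fun r _ => by
      have hrow : ∑ r, G.interference D q r * w r = ρ * w q := congrFun hPerron q
      rw [← h0, zero_mul, Finset.sum_eq_zero_iff_of_nonneg
        fun r _ => mul_nonneg (interference_nonneg q r) (hw r).le] at hrow
      exact (mul_eq_zero.mp (hrow r (Finset.mem_univ r))).resolve_right (hw r).ne'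
    have hBR : G.bestResponse q Q = G.bestResponse q Q' := by
      ext Y
      simp only [bestResponse, ee_update, hD.gain_eq hG hS hQ hQ']
    obtain ⟨Y, -, hY, -⟩ := exists_bestResponse hG (q := q) fun r _ => (hQ' r).1
    rw [hBR, hY] at hX
    rw [hY] at hX'
    rw [Set.mem_singleton_iff.mp hX, Set.mem_singleton_iff.mp hX', sub_self, norm_zero]
    exact mul_nonneg (by norm_num) (mul_nonneg (hw q).le (blockNorm_nonneg hw _))
  -- `K` bounds all dimensions at once, so that one cosine `c` serves all players.
  set K : ℝ := ∑ q, (nT q : ℝ) with hK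
  have hnK : ∀ q, (nT q : ℝ) ≤ K := fun q =>
    Finset.single_le_sum (f := fun q => (nT q : ℝ)) (fun _ _ => Nat.cast_nonneg _)
      (Finset.mem_univ q)
  have hn0 : ∀ q, (0 : ℝ) < nT q := fun q => by exact_mod_cast hG.dim_pos q
  have hK0 : 0 < K := (hn0 0).trans_le (hnK 0)
  set c : ℝ := √(1 - 1 / K) with hc
  have hc1 : c < 1 := by
    rw [hc, Real.sqrt_lt' one_pos]
    have : 0 < 1 / K := by positivity
    linarith
  -- With `c = 1` this would be `(ρ + (1 - ρ)) ^ 2 = 1`; it is smaller because `c < 1` and `ρ (1 -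
  -- ρ) > 0`.
  set b : ℝ := ρ ^ 2 + (1 - ρ) ^ 2 + 2 * (c * (ρ * (1 - ρ))) with hb
  have hcnn : 0 ≤ c := Real.sqrt_nonneg _
  have hbpos : 0 < b := by
    have : 0 ≤ c * (ρ * (1 - ρ)) := mul_nonneg hcnn (mul_nonneg hρ (by linarith))
    nlinarith [pow_pos hρ0 2, sq_nonneg (1 - ρ)]
  have hb1 : b < 1 := by
    have : c * (ρ * (1 - ρ)) < 1 * (ρ * (1 - ρ)) :=
      mul_lt_mul_of_pos_right hc1 (mul_pos hρ0 (by linarith))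
    nlinarith
  refine ⟨√b, Real.sqrt_pos.2 hbpos, by rwa [Real.sqrt_lt' one_pos, one_pow],
    fun Q hQ Q' hQ' q X hX X' hX' => ?_⟩
  obtain ⟨Y, ν, hY, hW, htr⟩ := exists_bestResponse hG (q := q) fun r _ => (hQ r).1
  obtain ⟨Y', ν', hY', hW', htr'⟩ := exists_bestResponse hG (q := q) fun r _ => (hQ' r).1
  rw [hY] at hX
  rw [hY'] at hX'
  rw [Set.mem_singleton_iff.mp hX, Set.mem_singleton_iff.mp hX']
  set d := w q * blockNorm w (Q - Q') with hd
  have hd0 : 0 ≤ d := mul_nonneg (hw q).le (blockNorm_nonneg hw _)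
  have hpow : |Y.trace.re - Y'.trace.re| ≤ (1 - ρ) * d := by
    rw [htr, htr']
    by_cases hQQ : Q = Q'
    · rw [hQQ, sub_self, abs_zero]
      exact mul_nonneg (by linarith) hd0
    · calc _ ≤ w q * vecNorm w (G.power Q - G.power Q') := abs_le_vecNorm hw _ q
        _ ≤ w q * ((1 - ρ) * blockNorm w (Q - Q')) :=
            mul_le_mul_of_nonneg_left (hcontr Q hQ Q' hQ' hQQ).le (hw q).le
        _ = _ := by rw [hd]; ring
  have : NeZero (nT q) := ⟨(hG.dim_pos q).ne'⟩
  have hgain : (G.gain q Q')⁻¹.PosDef := (gain_posDef hG fun r _ => (hQ' r).1).inv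
  have hmain := hW.norm_sub_sq_le_of_power hW' hgain (mul_nonneg hρ hd0)
    (or_iff_not_imp_left.mpr fun hq => hD.norm_inv_gain_sub_le hG hq hw hPerron hQ hQ') hpow
  refine abs_le_of_sq_le_sq' ?_ (mul_nonneg (Real.sqrt_nonneg _) hd0) |>.2
  rw [mul_pow, Real.sq_sqrt hbpos.le]
  refine hmain.trans ?_
  have hcq : √(1 - 1 / (nT q : ℝ)) ≤ c :=
    Real.sqrt_le_sqrt (sub_le_sub_left (one_div_le_one_div_of_le (hn0 q) (hnK q)) 1)
  have hprod : 0 ≤ ρ * d * ((1 - ρ) * d) :=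
    mul_nonneg (mul_nonneg hρ hd0) (mul_nonneg (by linarith) hd0)
  calc _ ≤ (ρ * d) ^ 2 + ((1 - ρ) * d) ^ 2 + 2 * (c * (ρ * d * ((1 - ρ) * d))) := by gcongr
    _ = b * d ^ 2 := by rw [hb]; ring

end Interference

end Network

/-! ### Restriction to the row space of the direct channel -/

section Isometry

variable {m n : Type*} [Fintype m] [Fintype n] [DecidableEq n]

/-- Compressing a positive semidefinite matrix to a subspace decreases its trace, strictly so unless
the matrix lives on that subspace. -/
lemma trace_compress_le [DecidableEq m] {V : Matrix m n ℂ} (hV : Vᴴ * V = 1) {Y : Matrix m m ℂ}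
    (hY : Y.PosSemidef) :
    (Vᴴ * Y * V).trace.re ≤ Y.trace.re ∧
      (Y.trace.re ≤ (Vᴴ * Y * V).trace.re → Y = V * (Vᴴ * Y * V) * Vᴴ) := by
  -- `E` is the complementary projection, and the trace of `E * Y * Eᴴ` is what compression loses.
  set E : Matrix m m ℂ := 1 - V * Vᴴ with hE
  have hEh : Eᴴ = E := by
    rw [hE, Matrix.conjTranspose_sub, Matrix.conjTranspose_one, Matrix.conjTranspose_mul,
      Matrix.conjTranspose_conjTranspose]
  have hEE : E * E = E := by
    have : V * Vᴴ * (V * Vᴴ) = V * Vᴴ := by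
      rw [Matrix.mul_assoc, ← Matrix.mul_assoc Vᴴ, hV, Matrix.one_mul]
    rw [hE, Matrix.sub_mul, Matrix.mul_sub, Matrix.mul_sub, this]
    simp
  have hpsd : (E * Y * Eᴴ).PosSemidef := hY.mul_mul_conjTranspose_same E
  have htr : (E * Y * Eᴴ).trace.re = Y.trace.re - (Vᴴ * Y * V).trace.re := by
    rw [hEh, Matrix.trace_mul_comm, ← Matrix.mul_assoc, hEE, hE, Matrix.sub_mul, Matrix.one_mul,
      Matrix.trace_sub, Complex.sub_re, Matrix.mul_assoc V, Matrix.trace_mul_comm V]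
  refine ⟨by linarith [trace_re_nonneg hpsd], fun h => ?_⟩
  have h0 := eq_zero_of_trace_re_nonpos hpsd (by linarith)
  obtain ⟨B, hB⟩ := exists_eq_conjTranspose_mul_self hY
  have hBE : B * E = 0 := by
    rw [← Matrix.conjTranspose_mul_self_eq_zero, ← h0, Matrix.conjTranspose_mul, hB, hEh]
    simp only [Matrix.mul_assoc]
  have hYE : Y * E = 0 := by rw [hB, Matrix.mul_assoc, hBE, Matrix.mul_zero]
  have hEY : E * Y = 0 := by
    have := congrArg Matrix.conjTranspose hYE
    rwa [Matrix.conjTranspose_mul, hY.1.eq, hEh, Matrix.conjTranspose_zero] at this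
  rw [hE, Matrix.sub_mul, Matrix.one_mul, sub_eq_zero] at hEY
  rw [hE, Matrix.mul_sub, Matrix.mul_one, sub_eq_zero] at hYE
  conv_lhs => rw [hEY, hYE]
  simp only [Matrix.mul_assoc]

lemma trace_isometry_conj {V : Matrix m n ℂ} (hV : Vᴴ * V = 1) (X : Matrix n n ℂ) :
    (V * X * Vᴴ).trace = X.trace := by
  rw [Matrix.trace_mul_comm, ← Matrix.mul_assoc, hV, Matrix.one_mul]

lemma compress_isometry_conj {V : Matrix m n ℂ} (hV : Vᴴ * V = 1) (X : Matrix n n ℂ) :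
    Vᴴ * (V * X * Vᴴ) * V = X := by
  rw [← Matrix.mul_assoc, ← Matrix.mul_assoc, hV, Matrix.one_mul, Matrix.mul_assoc, hV,
    Matrix.mul_one]

open scoped Matrix.Norms.Frobenius in
lemma norm_isometry_conj {V : Matrix m n ℂ} (hV : Vᴴ * V = 1) (X : Matrix n n ℂ) :
    ‖V * X * Vᴴ‖ = ‖X‖ := by
  rw [← sq_eq_sq₀ (norm_nonneg _) (norm_nonneg _), frobenius_sq, frobenius_sq]
  have : (V * X * Vᴴ)ᴴ * (V * X * Vᴴ) = V * (Xᴴ * X) * Vᴴ := by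
    simp only [Matrix.conjTranspose_mul, Matrix.conjTranspose_conjTranspose, Matrix.mul_assoc]
    rw [← Matrix.mul_assoc Vᴴ V, hV, Matrix.one_mul]
  rw [this, trace_isometry_conj hV]

/-- By Sylvester's determinant identity, only the compression of `Y` to the range of `V` carries
rate. -/
lemma userRate_isometry_conj [DecidableEq m] (V : Matrix m n ℂ) (A : Matrix n n ℂ) (Y : Matrix m m ℂ) :
    userRate (V * A * Vᴴ) Y = userRate A (Vᴴ * Y * V) := by
  rw [userRate, userRate, Matrix.mul_assoc V, Matrix.mul_assoc V, Matrix.det_one_add_mul_comm]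
  simp only [Matrix.mul_assoc]

/-- Seen through an isometry, the energy efficiency still has exactly one maximizer, and it lives on
the range of the isometry. -/
theorem exists_userEE_maximizer_isometry_conj [Nonempty n] [DecidableEq m] {V : Matrix m n ℂ}
    (hV : Vᴴ * V = 1) {A : Matrix n n ℂ} (hA : A.PosDef) {Ψ P : ℝ} (hΨ : 0 < Ψ) (hP : 0 < P) :
    ∃ X : Matrix n n ℂ, X.PosSemidef ∧ X.trace.re ≤ P ∧
      (∀ Y : Matrix n n ℂ, Y.PosSemidef → Y.trace.re ≤ P →
        userEE Ψ A Y ≤ userEE Ψ A X ∧ (userEE Ψ A Y = userEE Ψ A X → Y = X)) ∧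
      (∀ Y : Matrix m m ℂ, Y.PosSemidef → Y.trace.re ≤ P →
        userEE Ψ (V * A * Vᴴ) Y ≤ userEE Ψ (V * A * Vᴴ) (V * X * Vᴴ) ∧
          (userEE Ψ (V * A * Vᴴ) Y = userEE Ψ (V * A * Vᴴ) (V * X * Vᴴ) → Y = V * X * Vᴴ)) := by
  obtain ⟨_, X, _, -, -, hW, htr, hmax, hpos⟩ := exists_userEE_maximizers hA hΨ hP
  have hden : 0 < Ψ + X.trace.re := by linarith [trace_re_nonneg hW.posSemidef]
  have hEE : userEE Ψ (V * A * Vᴴ) (V * X * Vᴴ) = userEE Ψ A X := by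
    rw [userEE, userEE, userRate_isometry_conj, compress_isometry_conj hV, trace_isometry_conj hV]
  have hEEpos : 0 < userEE Ψ A X := div_pos hpos hden
  refine ⟨X, hW.posSemidef, htr.trans_le (min_le_left _ _), hmax, fun Y hY hYP => ?_⟩
  obtain ⟨h1, h2⟩ := trace_compress_le hV hY
  have hZpsd : (Vᴴ * Y * V).PosSemidef := hY.conjTranspose_mul_mul_same _
  have hYEE : userEE Ψ (V * A * Vᴴ) Y = userRate A (Vᴴ * Y * V) / (Ψ + Y.trace.re) := by
    rw [userEE, userRate_isometry_conj]
  rw [hEE, hYEE]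
  generalize Vᴴ * Y * V = Z at *
  have hZden : 0 < Ψ + Z.trace.re := by linarith [trace_re_nonneg hZpsd]
  -- A nonpositive rate cannot compete with the positive optimum. For a positive rate, compression
  -- keeps the rate and saves power, strictly unless `Y` lives on the range of `V`.
  rcases le_or_gt (userRate A Z) 0 with h0 | h0
  · have := (div_nonpos_of_nonpos_of_nonneg h0 (by linarith : 0 ≤ Ψ + Y.trace.re)).trans_lt hEEpos
    exact ⟨this.le, fun h => absurd h this.ne⟩
  · obtain ⟨h3, h4⟩ := hmax Z hZpsd (h1.trans hYP)
    have h5 : userRate A Z / (Ψ + Y.trace.re) ≤ userEE Ψ A Z :=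
      div_le_div_of_nonneg_left h0.le hZden (by linarith)
    refine ⟨h5.trans h3, fun h => ?_⟩
    have h6 : userEE Ψ A Z = userEE Ψ A X := le_antisymm h3 (h ▸ h5)
    rw [← h4 h6]
    refine h2 ?_
    have h7 : userRate A Z / (Ψ + Z.trace.re) ≤ userRate A Z / (Ψ + Y.trace.re) := by
      rw [h, ← h6, userEE]
    have := (div_le_div_iff_of_pos_left h0 hZden (by linarith)).mp h7
    linarith

end Isometry

/-! ### The reduced game -/

namespace Network

variable {N : ℕ} {nT nR r : Fin N → ℕ} {G : Network nT nR}
  {V : (q : Fin N) → Matrix (Fin (nT q)) (Fin (r q)) ℂ}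

/-- The columns of `V q` are an orthonormal basis of the row space of the direct channel of `q`. -/
structure IsReduction (G : Network nT nR)
    (V : (q : Fin N) → Matrix (Fin (nT q)) (Fin (r q)) ℂ) : Prop where
  isometry : ∀ q, (V q)ᴴ * V q = 1
  direct : ∀ q, G.H q q * V q * (V q)ᴴ = G.H q q
  regular : (G.reduced V).IsRegular

/-- The profile of the original game that a profile of the reduced game stands for. -/
noncomputable def lift (V : (q : Fin N) → Matrix (Fin (nT q)) (Fin (r q)) ℂ) (Q : Profile r) :
    Profile nT := fun q => V q * Q q * (V q)ᴴ

lemma mui_eq_reduced_mui {q : Fin N} {Q : Profile nT} {Q' : Profile r}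
    (h : ∀ s, s ≠ q → Q s = V s * Q' s * (V s)ᴴ) : G.mui q Q = (G.reduced V).mui q Q' := by
  rw [mui, mui]
  refine congrArg _ (Finset.sum_congr rfl fun s hs => ?_)
  rw [h s (Finset.ne_of_mem_erase hs)]
  simp only [reduced, Matrix.conjTranspose_mul, Matrix.mul_assoc]

/-- Best responses are unique and live on the row space of the direct channel, where they are the
best responses of the reduced game if the others play there, too. -/
theorem IsReduction.exists_bestResponse (hV : G.IsReduction V) {q : Fin N} {Q : Profile nT}
    (hQ : ∀ s, s ≠ q → (Q s).PosSemidef) :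
    ∃ X ∈ (G.reduced V).strat q, G.bestResponse q Q = {V q * X * (V q)ᴴ} ∧
      ∀ Q' : Profile r, (∀ s, s ≠ q → Q s = V s * Q' s * (V s)ᴴ) →
        (G.reduced V).bestResponse q Q' = {X} := by
  have : NeZero (r q) := ⟨(hV.regular.dim_pos q).ne'⟩
  have hΨ : 0 < G.Ψ q := hV.regular.Ψ_pos q
  have hiso := hV.isometry q
  set A := (G.H q q * V q)ᴴ * (G.mui q Q)⁻¹ * (G.H q q * V q) with hA
  have hnoise : (G.noise q).PosDef := hV.regular.noise_posDef q
  have hinj : Function.Injective (G.H q q * V q).mulVec := hV.regular.injective q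
  have hP : 0 < G.P q := hV.regular.P_pos q
  have hApd : A.PosDef := (mui_posDef hnoise hQ).inv.conjTranspose_mul_mul_same hinj
  have hgain : G.gain q Q = V q * A * (V q)ᴴ := by
    rw [gain]
    conv_lhs => rw [← hV.direct q]
    simp only [hA, Matrix.conjTranspose_mul, Matrix.conjTranspose_conjTranspose, Matrix.mul_assoc]
  obtain ⟨X, hX, hXP, hmax, hmax'⟩ :=
    exists_userEE_maximizer_isometry_conj hiso hApd hΨ hP
  refine ⟨X, ⟨hX, hXP⟩, ?_, fun Q' hQ' => ?_⟩
  · refine bestResponse_eq_singleton ⟨hX.mul_mul_conjTranspose_same _, ?_⟩ fun Y hY => ?_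
    · rw [trace_isometry_conj hiso]
      exact hXP
    · rw [hgain]
      exact hmax' Y hY.1 hY.2
  · have hgain' : (G.reduced V).gain q Q' = A := by
      rw [gain, ← mui_eq_reduced_mui hQ']
      rfl
    refine bestResponse_eq_singleton ⟨hX, hXP⟩ fun Y hY => ?_
    rw [hgain']
    exact hmax Y hY.1 hY.2

end Network

lemma IsCompactSVD.mul_mul_conjTranspose {m n r : ℕ} {A : Matrix (Fin m) (Fin n) ℂ}
    {U : Matrix (Fin m) (Fin r) ℂ} {σ : Fin r → ℝ} {V : Matrix (Fin n) (Fin r) ℂ}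
    (h : IsCompactSVD A U σ V) : A * V * Vᴴ = A := by
  conv_lhs => rw [h.eq]
  conv_rhs => rw [h.eq]
  rw [Matrix.mul_assoc _ Vᴴ V, h.right, Matrix.mul_one]

lemma IsCompactSVD.injective {m n r : ℕ} {A : Matrix (Fin m) (Fin n) ℂ}
    {U : Matrix (Fin m) (Fin r) ℂ} {σ : Fin r → ℝ} {V : Matrix (Fin n) (Fin r) ℂ}
    (h : IsCompactSVD A U σ V) : Function.Injective (A * V).mulVec := by
  have h1 : Matrix.diagonal (fun i => (σ i : ℂ)⁻¹) * Uᴴ * (A * V) = 1 := by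
    rw [h.eq, Matrix.mul_assoc _ Vᴴ V, h.right, Matrix.mul_one, Matrix.mul_assoc,
      ← Matrix.mul_assoc Uᴴ, h.left, Matrix.one_mul, Matrix.diagonal_mul_diagonal,
      ← Matrix.diagonal_one]
    congr 1
    ext i
    exact inv_mul_cancel₀ (by exact_mod_cast (h.pos i).ne')
  intro x y hxy
  have := congrArg (fun z => (Matrix.diagonal (fun i => (σ i : ℂ)⁻¹) * Uᴴ) *ᵥ z) hxy
  simpa only [Matrix.mulVec_mulVec, h1, Matrix.one_mulVec] using this

lemma IsCompactSVD.rank_pos {m n r : ℕ} {A : Matrix (Fin m) (Fin n) ℂ}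
    {U : Matrix (Fin m) (Fin r) ℂ} {σ : Fin r → ℝ} {V : Matrix (Fin n) (Fin r) ℂ}
    (h : IsCompactSVD A U σ V) (hA : A ≠ 0) : 0 < r := by
  rcases Nat.eq_zero_or_pos r with rfl | hr
  · refine absurd ?_ hA
    rw [h.eq]
    ext i j
    simp [Matrix.mul_apply]
  · exact hr

/-! ### Update rounds of asynchronous schedules -/

namespace Schedule

variable {N : ℕ} {s : Schedule N}

lemma IsTotallyAsync.exists_isRoundSeq (hs : s.IsTotallyAsync) : ∃ e, s.IsRoundSeq e := by
  have hstep : ∀ m, ∃ m', ∃ a, m ≤ a ∧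
      (∀ q r, r ≠ q → ∀ t ∈ s.updates q, a ≤ t → m ≤ s.meas q r t) ∧
      ∀ q, ∃ t ∈ s.updates q, a ≤ t ∧ t < m' := by
    intro m
    have h1 : ∀ᶠ a in Filter.atTop, ∀ q r, r ≠ q → ∀ t ∈ s.updates q, a ≤ t →
        m ≤ s.meas q r t := by
      refine Filter.eventually_all.2 fun q => Filter.eventually_all.2 fun r => ?_
      by_cases hr : r = q
      · exact Filter.Eventually.of_forall fun _ h => absurd hr h
      · obtain ⟨t₀, ht₀⟩ := hs.2 q r hr m
        filter_upwards [Filter.eventually_ge_atTop t₀] with a ha _ t ht hat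
        exact ht₀ t ht (ha.trans hat)
    obtain ⟨a, ha, hma⟩ := (h1.and (Filter.eventually_ge_atTop m)).exists
    have h2 : ∀ q, ∃ t ∈ s.updates q, a < t := fun q => (hs.1 q).exists_gt a
    choose t ht hat using h2
    obtain ⟨m', hm'⟩ := (Filter.eventually_all.2 fun q => Filter.eventually_gt_atTop (t q)).exists
    exact ⟨m', a, hma, ha, fun q => ⟨t q, ht q, (hat q).le, hm' q⟩⟩
  choose next hnext using hstep
  exact ⟨fun k => Nat.rec 0 (fun _ m => next m) k, rfl, fun k => hnext _⟩

/-- In the first `B` steps of a round the old information expires; in the next `B` every player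
updates. -/
lemma IsPartiallyAsync.isRoundSeq {B : ℕ} (hs : s.IsPartiallyAsync B) :
    s.IsRoundSeq fun k => 2 * B * k := by
  refine ⟨rfl, fun k => ⟨2 * B * k + B, Nat.le_add_right _ _, fun q r hr t ht hat => ?_,
    fun q => ?_⟩⟩
  · have := hs.2 q r hr t ht
    change 2 * B * k ≤ _
    omega
  · obtain ⟨t, ht, h1, h2⟩ := hs.1 q (2 * B * k + B)
    refine ⟨t, ht, h1, ?_⟩
    change t < 2 * B * (k + 1)
    rw [mul_add]
    omega

lemma isRoundSeq_synchronous : (synchronous N).IsRoundSeq id :=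
  ⟨rfl, fun k => ⟨k, le_rfl, fun _ _ _ _ _ h => h,
    fun _ => ⟨k, Set.mem_univ k, le_rfl, Nat.lt_succ_self k⟩⟩⟩

lemma isRoundSeq_sequential : (sequential N).IsRoundSeq fun k => N * k := by
  refine ⟨rfl, fun k => ⟨N * k, le_rfl, fun _ _ _ _ _ h => h, fun q => ⟨N * k + q, ?_, ?_, ?_⟩⟩⟩
  · change (N * k + q) % N = q
    rw [Nat.mul_add_mod, Nat.mod_eq_of_lt q.2]
  · exact Nat.le_add_right _ _
  · have := q.2
    change N * k + q < N * (k + 1)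
    rw [mul_add]
    omega

/-- The errors `b q t` shrink by the factor `β` in every round, once every player has updated. -/
lemma IsRoundSeq.le_pow {e : ℕ → ℕ} (he : s.IsRoundSeq e) {good : Fin N → ℕ → Prop}
    {b : Fin N → ℕ → ℝ} {K β : ℝ} (hK : ∀ q t, b q t ≤ K) (hK0 : 0 ≤ K) (hβ : 0 ≤ β)
    (hkeep : ∀ q, ∀ t ∉ s.updates q, b q (t + 1) = b q t ∧ (good q t → good q (t + 1)))
    (hgood : ∀ q, ∀ t ∈ s.updates q, good q (t + 1))
    (hstep : ∀ q, ∀ t ∈ s.updates q, ∀ c, 0 ≤ c →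
      (∀ r, r ≠ q → good r (s.meas q r t) ∧ b r (s.meas q r t) ≤ c) → b q (t + 1) ≤ β * c) :
    ∀ k q t, e (k + 1) ≤ t → good q t ∧ b q t ≤ K * β ^ k := by
  -- A bound that holds after every update with information from `e k` on persists once the player
  -- has updated in the round: later updates use such information too, and other times keep the
  -- strategy.
  have hround : ∀ k c, (∀ q, ∀ t ∈ s.updates q, (∀ r, r ≠ q → e k ≤ s.meas q r t) →
      b q (t + 1) ≤ c) → ∀ q t, e (k + 1) ≤ t → good q t ∧ b q t ≤ c := by
    intro k c hc q t ht
    obtain ⟨a, -, hmeas, hupd⟩ := he.2 k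
    obtain ⟨u, hu, hau, hue⟩ := hupd q
    have : ∀ t, u + 1 ≤ t → good q t ∧ b q t ≤ c := by
      intro t hut
      induction t, hut using Nat.le_induction with
      | base => exact ⟨hgood q u hu, hc q u hu fun r hr => hmeas q r hr u hu hau⟩
      | succ t hut ih =>
        by_cases htu : t ∈ s.updates q
        · exact ⟨hgood q t htu, hc q t htu fun r hr => hmeas q r hr t htu (by omega)⟩
        · exact ⟨(hkeep q t htu).2 ih.1, (hkeep q t htu).1 ▸ ih.2⟩
    exact this t (by omega)
  intro k
  induction k with
  -- The first round only makes every player `good`; the measured strategies need not be, so nothing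
  -- contracts yet.
  | zero => exact hround 0 _ fun q t _ _ => by simpa using hK q (t + 1)
  | succ k ih =>
    refine hround (k + 1) _ fun q t ht hm => ?_
    rw [pow_succ', mul_left_comm]
    exact hstep q t ht _ (mul_nonneg hK0 (pow_nonneg hβ k)) fun r hr => ih r _ (hm r hr)

end Schedule

/-! ### Block norm and entrywise convergence -/

section Topology

variable {N : ℕ} {d : Fin N → ℕ} {w : Fin N → ℝ}

open scoped Matrix.Norms.Frobenius in
lemma tendsto_of_blockNorm (hw : ∀ q, 0 < w q) {ι : Type*} {l : Filter ι} {A : ι → Profile d}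
    {B : Profile d} (h : Filter.Tendsto (fun i => blockNorm w (A i - B)) l (nhds 0)) :
    Filter.Tendsto A l (nhds B) := by
  refine tendsto_pi_nhds.2 fun q => tendsto_pi_nhds.2 fun i => tendsto_pi_nhds.2 fun j => ?_
  rw [tendsto_iff_norm_sub_tendsto_zero]
  refine squeeze_zero (fun _ => norm_nonneg _) (fun k => ?_)
    (by simpa using h.const_mul (w q))
  exact (norm_entry_le (A k q - B q) i j).trans (norm_le_blockNorm hw (A k - B) q)

/-- The maximum over the blocks is dominated by their sum, which is visibly continuous in the
entries. -/
lemma tendsto_blockNorm (hw : ∀ q, 0 < w q) {ι : Type*} {l : Filter ι} {A : ι → Profile d}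
    {B : Profile d} (h : Filter.Tendsto A l (nhds B)) :
    Filter.Tendsto (fun i => blockNorm w (A i - B)) l (nhds 0) := by
  have hcont : Continuous fun X : Profile d =>
      ∑ q, √(∑ p : Fin (d q) × Fin (d q), ‖(X q - B q) p.1 p.2‖ ^ 2) / w q := by
    refine continuous_finsetSum _ fun q _ => Continuous.div_const (Real.continuous_sqrt.comp
      (continuous_finsetSum _ fun p _ => ?_)) _
    have : Continuous fun X : Profile d => X q p.1 p.2 :=
      (continuous_apply_apply p.1 p.2).comp (continuous_apply (A := fun q => Fin (d q) → Fin (d q) → ℂ) q)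
    exact (this.sub continuous_const).norm.pow 2
  have h0 := (hcont.tendsto B).comp h
  simp only [sub_self, Matrix.zero_apply, norm_zero, ne_eq, OfNat.ofNat_ne_zero, not_false_eq_true,
    zero_pow, Finset.sum_const_zero, Real.sqrt_zero, zero_div] at h0
  refine squeeze_zero (fun _ => blockNorm_nonneg hw _) (fun i => ?_) h0
  have hnn : ∀ q, 0 ≤ √(∑ p : Fin (d q) × Fin (d q), ‖(A i q - B q) p.1 p.2‖ ^ 2) / w q :=
    fun q => div_nonneg (Real.sqrt_nonneg _) (hw q).le
  refine blockNorm_le hw (Finset.sum_nonneg fun q _ => hnn q) fun q => ?_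
  rw [mul_comm, ← div_le_iff₀ (hw q), ← norm_frobVec, EuclideanSpace.norm_eq]
  exact Finset.single_le_sum (f := fun q =>
    √(∑ p : Fin (d q) × Fin (d q), ‖(A i q - B q) p.1 p.2‖ ^ 2) / w q) (fun q _ => hnn q)
    (Finset.mem_univ q)

end Topology

/-! ### Existence of an equilibrium -/

namespace Network

variable {N : ℕ} {nT nR : Fin N → ℕ} {G : Network nT nR}

open scoped Matrix.Norms.Frobenius in
/-- A game whose best response is a contraction has a Nash equilibrium. -/
theorem exists_isNash (hG : G.IsRegular) {w : Fin N → ℝ} (hw : ∀ q, 0 < w q) {β : ℝ}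
    (hβ : 0 < β) (hβ1 : β < 1)
    (hcontr : ∀ Q ∈ G.profiles, ∀ Q' ∈ G.profiles, ∀ q, ∀ X ∈ G.bestResponse q Q,
      ∀ X' ∈ G.bestResponse q Q', ‖X - X'‖ ≤ β * (w q * blockNorm w (Q - Q'))) :
    ∃ Q ∈ G.profiles, G.IsNash Q := by
  have hex : ∀ Q : G.profiles, ∃ Q' : G.profiles, ∀ q, Q'.1 q ∈ G.bestResponse q Q.1 := by
    intro Q
    have : ∀ q, ∃ X, X ∈ G.bestResponse q Q.1 := fun q =>
      let ⟨X, _, hX, _⟩ := exists_bestResponse hG (q := q) fun r _ => (Q.2 r).1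
      ⟨X, hX ▸ Set.mem_singleton X⟩
    choose X hX using this
    exact ⟨⟨X, fun q => (hX q).1⟩, hX⟩
  choose F hF using hex
  have hFc : ∀ Q Q' : G.profiles, ∀ q,
      ‖(F Q).1 q - (F Q').1 q‖ ≤ w q * (β * blockNorm w (Q.1 - Q'.1)) := fun Q Q' q =>
    (hcontr Q.1 Q.2 Q'.1 Q'.2 q _ (hF Q q) _ (hF Q' q)).trans_eq (mul_left_comm _ _ _)
  let x : ℕ → G.profiles := fun n => F^[n] ⟨0, zero_mem_profiles hG⟩
  have hx : ∀ n, x (n + 1) = F (x n) := fun n => Function.iterate_succ_apply' _ _ _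
  have hstep : ∀ n, blockNorm w ((x (n + 1)).1 - (x n).1) ≤
      β ^ n * blockNorm w ((x 1).1 - (x 0).1) := by
    intro n
    induction n with
    | zero => simp
    | succ n ih =>
      refine blockNorm_le hw (mul_nonneg (by positivity) (blockNorm_nonneg hw _)) fun q => ?_
      have h1 := hFc (x (n + 1)) (x n) q
      rw [← hx, ← hx] at h1
      refine h1.trans (mul_le_mul_of_nonneg_left ?_ (hw q).le)
      rw [pow_succ', mul_assoc]
      exact mul_le_mul_of_nonneg_left ih hβ.le
  have : FirstCountableTopology (Profile nT) :=
    inferInstanceAs (FirstCountableTopology ((q : Fin N) → Fin (nT q) → Fin (nT q) → ℂ))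
  -- Compactness gives a cluster point of the best-response iterates; since consecutive iterates
  -- approach each other, it is a fixed point.
  obtain ⟨Q, hQ, φ, hφ, hlim⟩ := (isCompact_profiles G).tendsto_subseq fun n => (x n).2
  refine ⟨Q, hQ, fun q => ?_⟩
  have h1 := tendsto_blockNorm hw hlim
  have h2 : Filter.Tendsto (fun n => β ^ φ n * blockNorm w ((x 1).1 - (x 0).1)) Filter.atTop
      (nhds 0) := by
    simpa using ((tendsto_pow_atTop_nhds_zero_of_lt_one hβ.le hβ1).comp
      hφ.tendsto_atTop).mul_const (blockNorm w ((x 1).1 - (x 0).1))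
  have h3 : ‖(F ⟨Q, hQ⟩).1 q - Q q‖ ≤ 0 := by
    have hlim0 := (((h1.const_mul β).add h2).add h1).const_mul (w q)
    simp only [mul_zero, add_zero] at hlim0
    refine ge_of_tendsto' hlim0 fun n => ?_
    have a1 := hFc ⟨Q, hQ⟩ (x (φ n)) q
    have a2 := (norm_le_blockNorm hw ((x (φ n + 1)).1 - (x (φ n)).1) q).trans
      (mul_le_mul_of_nonneg_left (hstep (φ n)) (hw q).le)
    have a3 := norm_le_blockNorm hw ((x (φ n)).1 - Q) q
    have e0 : blockNorm w (Q - (x (φ n)).1) = blockNorm w ((x (φ n)).1 - Q) := by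
      unfold blockNorm
      refine iSup_congr fun q => ?_
      rw [Pi.sub_apply, Pi.sub_apply, norm_sub_rev]
    rw [hx] at a2
    have e1 : (F ⟨Q, hQ⟩).1 q - Q q = ((F ⟨Q, hQ⟩).1 q - (F (x (φ n))).1 q) +
        ((F (x (φ n))).1 - (x (φ n)).1) q + ((x (φ n)).1 - Q) q := by
      simp only [Pi.sub_apply]
      abel
    rw [e1]
    refine (norm_add₃_le).trans ?_
    simp only [e0] at a1
    simp only [Function.comp_apply]
    linarith
  have h4 : (F ⟨Q, hQ⟩).1 q = Q q := sub_eq_zero.mp (norm_eq_zero.mp (le_antisymm h3 (norm_nonneg _)))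
  rw [← h4]
  exact hF ⟨Q, hQ⟩ q

end Network

/-! ### Convergence of runs -/

namespace Network

variable {N : ℕ} {nT nR r : Fin N → ℕ} {G : Network nT nR}
  {V : (q : Fin N) → Matrix (Fin (nT q)) (Fin (r q)) ℂ}

lemma IsReduction.isNash_lift (hV : G.IsReduction V) {Q : Profile r}
    (hQ : Q ∈ (G.reduced V).profiles) (hnash : (G.reduced V).IsNash Q) :
    G.IsNash (lift V Q) := by
  intro q
  obtain ⟨X, -, hX, hX'⟩ := hV.exists_bestResponse (q := q) (Q := lift V Q)
    fun s _ => (hQ s).1.mul_mul_conjTranspose_same _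
  have h1 := hnash q
  rw [hX' Q fun _ _ => rfl, Set.mem_singleton_iff] at h1
  rw [hX, Set.mem_singleton_iff, ← h1]
  rfl

/-- A best response to reduced strategies is as close to an equilibrium as the contraction of the
reduced game says. -/
lemma IsReduction.norm_bestResponse_sub_le (hV : G.IsReduction V) {w : Fin N → ℝ}
    (hw : ∀ q, 0 < w q) {β : ℝ} (hβ : 0 ≤ β)
    (hcontr : ∀ Q ∈ (G.reduced V).profiles, ∀ Q' ∈ (G.reduced V).profiles, ∀ q,
      ∀ X ∈ (G.reduced V).bestResponse q Q, ∀ X' ∈ (G.reduced V).bestResponse q Q',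
        open scoped Matrix.Norms.Frobenius in
        ‖X - X'‖ ≤ β * (w q * blockNorm w (Q - Q')))
    {Qs : Profile r} (hQs : Qs ∈ (G.reduced V).profiles) (hnash : (G.reduced V).IsNash Qs)
    {q : Fin N} {Q : Profile nT} {X : Matrix (Fin (nT q)) (Fin (nT q)) ℂ}
    (hX : X ∈ G.bestResponse q Q) {c : ℝ} (hc : 0 ≤ c)
    (hQ : ∀ s, s ≠ q → ∃ Y ∈ (G.reduced V).strat s, Q s = V s * Y * (V s)ᴴ)
    (hQc : open scoped Matrix.Norms.Frobenius in
      ∀ s, s ≠ q → ‖Q s - lift V Qs s‖ ≤ w s * c) :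
    open scoped Matrix.Norms.Frobenius in ‖X - lift V Qs q‖ ≤ w q * (β * c) := by
  open scoped Matrix.Norms.Frobenius in
  have hex : ∀ s, ∃ Y ∈ (G.reduced V).strat s, (s ≠ q → Q s = V s * Y * (V s)ᴴ) ∧
      ‖Y - Qs s‖ ≤ w s * c := by
    intro s
    by_cases hs : s = q
    -- The own block does not affect the best response, so it can be set to the equilibrium, with no
    -- error.
    · exact ⟨Qs s, hQs s, fun h => absurd hs h, by
        rw [sub_self, norm_zero]; exact mul_nonneg (hw s).le hc⟩
    · obtain ⟨Y, hY, hQY⟩ := hQ s hs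
      refine ⟨Y, hY, fun _ => hQY, ?_⟩
      have h1 := hQc s hs
      rwa [hQY, lift, ← Matrix.sub_mul, ← Matrix.mul_sub, norm_isometry_conj (hV.isometry s)] at h1
  choose Q' hQ' hlift hnorm using hex
  obtain ⟨Z, -, hZ, hZ'⟩ := hV.exists_bestResponse (q := q) (Q := Q) fun s hs => by
    rw [hlift s hs]
    exact (hQ' s).1.mul_mul_conjTranspose_same _
  rw [hZ, Set.mem_singleton_iff] at hX
  have hZmem : Z ∈ (G.reduced V).bestResponse q Q' := by
    rw [hZ' Q' hlift]
    exact Set.mem_singleton Z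
  rw [hX, lift, ← Matrix.sub_mul, ← Matrix.mul_sub, norm_isometry_conj (hV.isometry q)]
  refine (hcontr Q' hQ' Qs hQs q Z hZmem (Qs q) (hnash q)).trans ?_
  rw [mul_left_comm]
  refine mul_le_mul_of_nonneg_left (mul_le_mul_of_nonneg_left ?_ hβ) (hw q).le
  exact blockNorm_le hw hc hnorm

lemma mem_profiles_of_isRun {s : Schedule N} {Q : ℕ → Profile nT} (hQ : IsRun G s Q) (t : ℕ) :
    Q t ∈ G.profiles := by
  induction t with
  | zero => exact hQ.1
  | succ t ih =>
    intro q
    by_cases ht : t ∈ s.updates q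
    · exact (hQ.2.1 q t ht).1
    · rw [hQ.2.2 q t ht]
      exact ih q

open scoped Matrix.Norms.Frobenius in
/-- Linear convergence, round by round, of all runs to an equilibrium of the reduced game. -/
theorem IsReduction.blockNorm_le (hV : G.IsReduction V) {w : Fin N → ℝ}
    (hw : ∀ q, 0 < w q) {β : ℝ} (hβ : 0 < β)
    (hcontr : ∀ Q ∈ (G.reduced V).profiles, ∀ Q' ∈ (G.reduced V).profiles, ∀ q,
      ∀ X ∈ (G.reduced V).bestResponse q Q, ∀ X' ∈ (G.reduced V).bestResponse q Q',
        ‖X - X'‖ ≤ β * (w q * blockNorm w (Q - Q')))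
    {Qs : Profile r} (hQs : Qs ∈ (G.reduced V).profiles) (hnash : (G.reduced V).IsNash Qs) :
    ∃ C, 0 ≤ C ∧ ∀ (s : Schedule N) (Q : ℕ → Profile nT), IsRun G s Q → ∀ e, s.IsRoundSeq e →
      ∀ k t, e k ≤ t → blockNorm w (Q t - lift V Qs) ≤ C * β ^ k := by
  have hP : ∀ q, 0 < G.P q := hV.regular.P_pos
  have hQs' : lift V Qs ∈ G.profiles := fun q => (hV.isNash_lift hQs hnash q).1
  -- `K` bounds every weighted error, since two strategies of `q` differ by at most `2 * G.P q`.
  set K := ∑ q, 2 * G.P q / w q with hK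
  have hterm : ∀ q, 0 ≤ 2 * G.P q / w q :=
    fun q => div_nonneg (mul_nonneg zero_le_two (hP q).le) (hw q).le
  have hK0 : 0 ≤ K := Finset.sum_nonneg fun q _ => hterm q
  -- `K / β` pays for the first round, in which `le_pow` gives no contraction; `K` covers `k = 0`.
  refine ⟨K / β + K, add_nonneg (div_nonneg hK0 hβ.le) hK0, fun s Q hQ e he k t ht => ?_⟩
  have hmem := mem_profiles_of_isRun hQ
  have hbound : ∀ q t, ‖Q t q - lift V Qs q‖ / w q ≤ K := by
    intro q t
    refine le_trans ?_ (Finset.single_le_sum (fun q _ => hterm q) (Finset.mem_univ q))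
    refine div_le_div_of_nonneg_right ?_ (hw q).le
    have h1 := norm_sub_le (Q t q) (lift V Qs q)
    have h2 := norm_le_of_mem_strat (hmem t q)
    have h3 := norm_le_of_mem_strat (hQs' q)
    linarith
  cases k with
  | zero =>
    rw [pow_zero, mul_one]
    refine EEGame.blockNorm_le hw (by positivity) fun q => ?_
    have h1 : K ≤ K / β + K := le_add_of_nonneg_left (by positivity)
    have h2 := (hbound q t).trans h1
    rwa [div_le_iff₀ (hw q), mul_comm] at h2
  | succ k =>
    have hmain := he.le_pow
      -- Good means playing on the row space, where the contraction of the reduced game applies.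
      (good := fun q t => ∃ Y ∈ (G.reduced V).strat q, Q t q = V q * Y * (V q)ᴴ)
      (b := fun q t => ‖Q t q - lift V Qs q‖ / w q) hbound hK0 hβ.le ?_ ?_ ?_ k
    · have hC : K * β ^ k ≤ (K / β + K) * β ^ (k + 1) := by
        rw [add_mul, pow_succ', ← mul_assoc, div_mul_cancel₀ _ hβ.ne']
        exact le_add_of_nonneg_right (by positivity)
      refine le_trans ?_ hC
      refine EEGame.blockNorm_le hw (mul_nonneg hK0 (pow_nonneg hβ.le k)) fun q => ?_
      have := (hmain q t ht).2
      rwa [div_le_iff₀ (hw q), mul_comm] at this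
    · intro q t ht
      simp only [hQ.2.2 q t ht]
      exact ⟨trivial, fun h => h⟩
    · intro q t ht
      obtain ⟨X, hX, hBR, -⟩ := hV.exists_bestResponse (q := q)
        (Q := fun r => Q (s.meas q r t) r) fun p _ => (hmem _ p).1
      have h1 := hQ.2.1 q t ht
      rw [hBR] at h1
      exact ⟨X, hX, h1⟩
    · intro q t ht c hc h
      rw [div_le_iff₀ (hw q), mul_comm]
      refine hV.norm_bestResponse_sub_le hw hβ.le hcontr hQs hnash (hQ.2.1 q t ht) hc
        (fun p hp => (h p hp).1) fun p hp => ?_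
      have := (h p hp).2
      rwa [div_le_iff₀ (hw p), mul_comm] at this

end Network

/-- A Nash equilibrium is a constant run of the synchronous algorithm. -/
lemma Network.IsNash.isRun_const {N : ℕ} {nT nR : Fin N → ℕ} {G : Network nT nR} {Q : Profile nT}
    (hQ : G.IsNash Q) : IsRun G (Schedule.synchronous N) fun _ => Q :=
  ⟨fun q => (hQ q).1, fun q _ _ => hQ q, fun _ t ht => absurd (Set.mem_univ t) ht⟩

lemma tendsto_of_blockNorm_le {N : ℕ} {d : Fin N → ℕ} {w : Fin N → ℝ} (hw : ∀ q, 0 < w q)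
    {C β : ℝ} (hβ : 0 ≤ β) (hβ1 : β < 1) {e : ℕ → ℕ} {A : ℕ → Profile d} {B : Profile d}
    (h : ∀ k t, e k ≤ t → blockNorm w (A t - B) ≤ C * β ^ k) :
    Filter.Tendsto A Filter.atTop (nhds B) := by
  refine tendsto_of_blockNorm hw (tendsto_order.2 ⟨fun a ha => ?_, fun a ha => ?_⟩)
  · exact Filter.Eventually.of_forall fun t => ha.trans_le (blockNorm_nonneg hw _)
  · have h0 : Filter.Tendsto (fun k => C * β ^ k) Filter.atTop (nhds 0) := by
      simpa using (tendsto_pow_atTop_nhds_zero_of_lt_one hβ hβ1).const_mul C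
    obtain ⟨k, hk⟩ := (h0.eventually_lt_const ha).exists
    filter_upwards [Filter.eventually_ge_atTop (e k)] with t ht
    exact (h k t ht).trans_lt hk

end EEGame

theorem proposition6 {N : ℕ} {nT nR r : Fin N → ℕ} (G : EEGame.Network nT nR)
    (hnoise : ∀ q, (G.noise q).PosDef) (hP : ∀ q, 0 < G.P q) (hΨ : ∀ q, 0 < G.Ψ q)
    (hH : ∀ q, G.H q q ≠ 0)
    -- compact singular value decompositions of the direct channels
    (U : (q : Fin N) → Matrix (Fin (nR q)) (Fin (r q)) ℂ) (σ : (q : Fin N) → Fin (r q) → ℝ)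
    (V : (q : Fin N) → Matrix (Fin (nT q)) (Fin (r q)) ℂ)
    (hsvd : ∀ q, EEGame.IsCompactSVD (G.H q q) (U q) (σ q) (V q))
    -- the set over which the entries of the interference matrix are maximized
    (D : Set (EEGame.Profile r))
    (hD : (D = (G.reduced V).fullProfiles ∧
            ∀ q s, s ≠ q → r s = 1 → r q = 1 ∨ r q = nR q) ∨
          D = (G.reduced V).profiles)
    -- a positive right Perron eigenvector
    (w : Fin N → ℝ) (hw : ∀ q, 0 < w q)
    (hPerron : ((G.reduced V).interference D).mulVec w =
      EEGame.specRadius ((G.reduced V).interference D) • w)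
    -- the contraction condition
    (hcontr : ∀ Q ∈ (G.reduced V).profiles, ∀ Q' ∈ (G.reduced V).profiles, Q ≠ Q' →
      EEGame.vecNorm w ((G.reduced V).power Q - (G.reduced V).power Q') <
        (1 - EEGame.specRadius ((G.reduced V).interference D)) *
          EEGame.blockNorm w (Q - Q')) :
    ∃ Qs : EEGame.Profile nT, G.IsNash Qs ∧ (∀ Q, G.IsNash Q → Q = Qs) ∧
      -- convergence for every totally asynchronous schedule
      (∀ s : EEGame.Schedule N, s.IsTotallyAsync → ∀ Q, EEGame.IsRun G s Q →
        Filter.Tendsto Q Filter.atTop (nhds Qs)) ∧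
      -- linear rate, with constants that depend only on the game
      ∃ C β : ℝ, 0 ≤ C ∧ 0 ≤ β ∧ β < 1 ∧
        (∀ s : EEGame.Schedule N, s.IsTotallyAsync → ∀ Q, EEGame.IsRun G s Q →
          ∀ e, s.IsRoundSeq e → ∀ k t, e k ≤ t →
            EEGame.blockNorm w (Q t - Qs) ≤ C * β ^ k) ∧
        (∀ (s : EEGame.Schedule N) (B : ℕ), s.IsPartiallyAsync B → ∀ Q, EEGame.IsRun G s Q →
          ∀ t, EEGame.blockNorm w (Q t - Qs) ≤ C * β ^ (t / (2 * B))) ∧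
        (∀ Q, EEGame.IsRun G (EEGame.Schedule.synchronous N) Q →
          ∀ t, EEGame.blockNorm w (Q t - Qs) ≤ C * β ^ t) ∧
        (∀ Q, EEGame.IsRun G (EEGame.Schedule.sequential N) Q →
          ∀ t, EEGame.blockNorm w (Q t - Qs) ≤ C * β ^ (t / N)) := by
  -- Without players there is only one profile, and the block norm, an empty supremum, is `0`.
  rcases Nat.eq_zero_or_pos N with rfl | hN
  · have hz : ∀ A : EEGame.Profile nT, EEGame.blockNorm w A = 0 := fun A => Real.iSup_of_isEmpty _
    refine ⟨0, fun q => q.elim0, fun Q _ => Subsingleton.elim _ _, fun s _ Q _ => ?_, 0, 0, le_rfl,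
      le_rfl, one_pos, ?_⟩
    · rw [Subsingleton.elim Q fun _ => 0]
      exact tendsto_const_nhds
    · simp [hz]
  have : NeZero N := ⟨hN.ne'⟩
  have hV : G.IsReduction V :=
    { isometry := fun q => (hsvd q).right
      direct := fun q => (hsvd q).mul_mul_conjTranspose
      regular :=
        { noise_posDef := hnoise
          P_pos := hP
          Ψ_pos := hΨ
          dim_pos := fun q => (hsvd q).rank_pos (hH q)
          injective := fun q => (hsvd q).injective } }
  have hadm : (G.reduced V).IsAdmissible D := hD
  obtain ⟨β, hβ, hβ1, hβc⟩ :=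
    hadm.exists_contraction hV.regular hw ENNReal.toReal_nonneg hPerron hcontr
  obtain ⟨Qr, hQr, hnash⟩ := EEGame.Network.exists_isNash hV.regular hw hβ hβ1 hβc
  obtain ⟨C, hC, hrate⟩ := hV.blockNorm_le hw hβ hβc hQr hnash
  have hconv : ∀ s : EEGame.Schedule N, ∀ e, s.IsRoundSeq e → ∀ Q, EEGame.IsRun G s Q →
      Filter.Tendsto Q Filter.atTop (nhds (EEGame.Network.lift V Qr)) := fun s e he Q hQ =>
    EEGame.tendsto_of_blockNorm_le hw hβ.le hβ1 (hrate s Q hQ e he)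
  refine ⟨EEGame.Network.lift V Qr, hV.isNash_lift hQr hnash, fun Q hQ => ?_, fun s hs Q hQ => ?_,
    C, β, hC, hβ.le, hβ1, fun s _ Q hQ e he => hrate s Q hQ e he, fun s B hB Q hQ t => ?_,
    fun Q hQ t => ?_, fun Q hQ t => ?_⟩
  -- Another equilibrium is a constant synchronous run, which must converge to the lifted one.
  · exact tendsto_nhds_unique tendsto_const_nhds
      (hconv _ _ EEGame.Schedule.isRoundSeq_synchronous _ hQ.isRun_const)
  · obtain ⟨e, he⟩ := hs.exists_isRoundSeq
    exact hconv s e he Q hQ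
  · exact hrate s Q hQ _ hB.isRoundSeq _ _ (Nat.mul_div_le t (2 * B))
  · exact hrate _ Q hQ _ EEGame.Schedule.isRoundSeq_synchronous t t le_rfl
  · exact hrate _ Q hQ _ EEGame.Schedule.isRoundSeq_sequential _ _ (Nat.mul_div_le t N)
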